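/- For $n\in\mathbb N=\{1,2,\dots\}$ let $\Phi_n$ be the class of continuous functions $f:[0,\infty)\to\mathbb R$ such that $\sum_{k,l} f(|x_k-x_l|)\,\xi_l\overline{\xi_k}\ge 0$ for all finite families $x_1,\dots,x_N\in\mathbb R^n$ and $\xi_1,\dots,\xi_N\in\mathbb C$, where $|\cdot|$ is the Euclidean norm. Put $$\Omega_n(s)=\sum_{i=0}^\infty\frac{\Gamma(n/2)}{i!\,\Gamma(i+n/2)}\Bigl(-\frac{s^2}{4}\Bigr)^i .$$ The Schoenberg measure of $f\in\Phi_n$ is the finite positive Borel measure $\nu_n$ on $[0,\infty)$ with $f(r)=\int_{[0,\infty)}\Omega_n(rt)\,\nu_n(dt)$ for all $r\ge 0$. For $k\ge 1$, $AC^k_{\rm loc}(0,\infty)$ is the set of $g\in C^{k-1}(0,\infty)$ such that $g^{(k-1)}$ is absolutely continuous on every compact interval $[a,b]\subset(0,\infty)$. **Theorem.** Let $m,j\in\mathbb N$, and let $f\in\Phi_m\cap\Phi_{m+2j}$ be nonconstant, with Schoenberg measures $\nu_m$ and $\nu=\nu_{m+2j}$. Put $$p_m(x)=\frac{2x^{m-1}}{B(\frac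 m2,j)}\int_{(x,\infty)}\Bigl(1-\frac{x^2}{u^2}\Bigr)^{j-1}\frac{\nu(du)}{u^m},$$ where $B$ is the Euler beta function. Then $\nu_m(dx)=p_m(x)\,dx$ on $(0,\infty)$, and the following hold. (i) The distribution function $F(x)=\nu_m([0,x])$ is absolutely continuous on $[0,a]$ for every $a>0$ and belongs to $AC^j_{\rm loc}(0,\infty)$; if $j\ge 2$, then $p_m\in AC^{j-1}_{\rm loc}(0,\infty)$. (ii) If $\nu=p_{m+2j}\,dx$ is absolutely continuous on $(0,\infty)$ with $p_{m+2j}\in L^p(0,\infty)$ for some $1\le p<\infty$, then $p_m\in C^{j-1}(0,\infty)$, and for $k=0,1,\dots,j-1$ $$x^kp_m^{(k)}(x)\in L^p(0,\infty),\qquad p_m^{(k)}(x)=o\bigl(x^{-k-1}\bigr),\quad x\to\infty .$$ (iii) If $I:=\int_{(0,\infty)}\frac{\nu(du)}{u}<\infty$, then $p_m(0)=\lim_{x\to0+}p_m(x)=0$ when $m\ge2$, and $p_1(0)=\lim_{x\to0+}p_1(x)=\dfrac{2}{B(\frac12,j)}\,I$ when $m=1$ (that is, $I$ when $j=1$). Moreover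 $x^kp_m^{(k)}(x)\in L^\infty(0,\infty)$ for $k=0,1,\dots,j-1$ (for $k=j-1\ge1$ the derivative exists almost everywhere). -/

import Mathlib

open MeasureTheory Set Filter Topology

noncomputable section

open scoped ComplexOrder in
/-- The class `Φ_n`: `f`, viewed as a function on `[0,∞)` (its values at negative arguments play no
role), is real-valued, continuous, and `f(|x|)` is positive definite on Euclidean `ℝⁿ`. -/
def IsRPD (n : ℕ) (f : ℝ → ℝ) : Prop :=
  ContinuousOn f (Ici 0) ∧
    ∀ (N : ℕ) (x : Fin N → EuclideanSpace ℝ (Fin n)) (ξ : Fin N → ℂ),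
      0 ≤ ∑ k, ∑ l, (f ‖x k - x l‖ : ℂ) * ξ l * (starRingEnd ℂ) (ξ k)

/-- The Schoenberg kernel `Ω_n(s) = ∑_i Γ(q+1) / (i! Γ(i+q+1)) (-s²/4)^i`, with `q + 1 = n/2`. -/
def schoenbergKernel (n : ℕ) (s : ℝ) : ℝ :=
  ∑' i : ℕ, Real.Gamma (n / 2) / (i.factorial * Real.Gamma (i + n / 2)) * (-(s ^ 2) / 4) ^ i

/-- `ν` is the Schoenberg measure of `f` in dimension `n`: a finite Borel measure on `[0,∞)`
(seen as a measure on `ℝ` that does not charge the negative half-line) which represents `f`.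
Its total mass is `f 0`, so it is a probability measure exactly when `f 0 = 1`. -/
structure IsSchoenbergMeasure (n : ℕ) (f : ℝ → ℝ) (ν : Measure ℝ) : Prop where
  finite : IsFiniteMeasure ν
  support : ν (Iio 0) = 0
  repr : ∀ r : ℝ, 0 ≤ r → f r = ∫ t, schoenbergKernel n (r * t) ∂ν

/-- `AC_loc(0,∞)`: absolute continuity on each compact subinterval of `(0,∞)`. -/
def IsACLoc (g : ℝ → ℝ) : Prop :=
  ∀ a b : ℝ, 0 < a → a ≤ b → AbsolutelyContinuousOnInterval g a b

/-- `AC^k_loc(0,∞)` for `k ≥ 1`: `g` is of class `C^{k-1}` on `(0,∞)` and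
`g^{(k-1)}` is in `AC_loc(0,∞)`. -/
def IsACLocPow (k : ℕ) (g : ℝ → ℝ) : Prop :=
  ContDiffOn ℝ ((k - 1 : ℕ) : ℕ∞) g (Ioi 0) ∧ IsACLoc (iteratedDeriv (k - 1) g)

/-- The density of the `2j`-step transition formula (`j ≥ 1`), `x ≥ 0`:
`p_m(x) = 2 x^{m-1} / B(m/2, j) ∫_x^∞ (1 - x²/u²)^{j-1} u^{-m} ν(du)`. -/
def transitionDensity (m j : ℕ) (ν : Measure ℝ) (x : ℝ) : ℝ :=
  2 * x ^ (m - 1) / ProbabilityTheory.beta (m / 2) j *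
    ∫ u in Ioi x, (1 - x ^ 2 / u ^ 2) ^ (j - 1) / u ^ m ∂ν

end


/-! The measure `ν_m` is the law of `U √B`, where `U` has law `ν` and `B` is an independent
`Beta(m/2, j)` variable. Indeed Sonine's first integral says that averaging `Ω_m(r u √B)` over `B`
gives `Ω_{m+2j}(r u)`, so that the law of `U √B` represents `f` in dimension `m`; and the
representing measure is unique, because averaging over `r ^ 2` against a gamma law (Weber's
exponential integral) turns the `₀F₁` transform into a Laplace transform in `t ^ 2`.

The density is a tail integral `∫_{(x,∞)} P(x/u) u⁻¹ ν(du)` with a polynomial `P` vanishing to order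
`j - 1` at `1`. Since `P(1) = 0`, for each `u` the cut-off kernel is an indefinite integral in `x`,
so by Fubini the density is an indefinite integral of `∫_{(x,∞)} P'(x/u) u⁻² ν(du)`; this can be
repeated `j - 1` times. Moreover `x ^ k p_m^{(k)}(x)` is again a tail integral, with `P` replaced by
`X ^ k P^{(k)}`, hence is bounded by a multiple of `∫_{(x,∞)} ν(du)/u`. When `ν(du) = q(u) du`,
this is an average `∫_{(1,∞)} q(xt) dt/t` of dilates of `q`, which Minkowski's inequality bounds
in `L^p`.
-/

noncomputable section

open ProbabilityTheory

/-! ### The hypergeometric function `₀F₁` -/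

/-- The coefficient `1 / (i! (a)_i)` of `z ^ i` in `₀F₁(; a; z)`, with the Pochhammer symbol
`(a)_i` written as `Γ(i + a) / Γ(a)`. -/
def hypergeometric0F1Coeff (a : ℝ) (i : ℕ) : ℝ :=
  Real.Gamma a / (i.factorial * Real.Gamma (i + a))

/-- The hypergeometric function `₀F₁(; a; z)`; up to a power of `s`, the function
`₀F₁(; a; -s²/4)` is the Bessel function `J_{a-1}(s)`, and `a = n/2` gives `Ω_n(s)`. -/
def hypergeometric0F1 (a z : ℝ) : ℝ :=
  ∑' i : ℕ, hypergeometric0F1Coeff a i * z ^ i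

theorem schoenbergKernel_eq_hypergeometric0F1 (n : ℕ) (s : ℝ) :
    schoenbergKernel n s = hypergeometric0F1 (n / 2) (-(s ^ 2) / 4) := rfl

theorem hypergeometric0F1Coeff_pos {a : ℝ} (ha : 0 < a) (i : ℕ) :
    0 < hypergeometric0F1Coeff a i := by
  have := Real.Gamma_pos_of_pos ha
  have : 0 < Real.Gamma (i + a) := Real.Gamma_pos_of_pos (by positivity)
  unfold hypergeometric0F1Coeff
  positivity

theorem pow_mul_Gamma_le_Gamma_nat_add {a : ℝ} (ha : 0 < a) (i : ℕ) :
    a ^ i * Real.Gamma a ≤ Real.Gamma (i + a) := by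
  induction i with
  | zero => simp
  | succ i ih =>
    calc a ^ (i + 1) * Real.Gamma a = a * (a ^ i * Real.Gamma a) := by ring
      _ ≤ (i + a) * Real.Gamma (i + a) := by
        have := Real.Gamma_pos_of_pos ha
        gcongr
        exact le_add_of_nonneg_left i.cast_nonneg
      _ = Real.Gamma ((i + 1 : ℕ) + a) := by
        rw [← Real.Gamma_add_one (by positivity)]
        push_cast
        ring_nf

theorem hypergeometric0F1Coeff_le {a : ℝ} (ha : 0 < a) (i : ℕ) :
    hypergeometric0F1Coeff a i ≤ a⁻¹ ^ i / i.factorial := by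
  have := Real.Gamma_pos_of_pos ha
  have hΓi : 0 < Real.Gamma (i + a) := Real.Gamma_pos_of_pos (by positivity)
  have hle := pow_mul_Gamma_le_Gamma_nat_add ha i
  calc hypergeometric0F1Coeff a i = Real.Gamma a / Real.Gamma (i + a) / i.factorial := by
        rw [hypergeometric0F1Coeff, div_div, mul_comm]
    _ ≤ a⁻¹ ^ i / i.factorial := by
        gcongr
        rw [div_le_iff₀ hΓi, inv_pow, inv_mul_eq_div, le_div_iff₀ (by positivity)]
        linarith

theorem summable_hypergeometric0F1 {a : ℝ} (ha : 0 < a) (z : ℝ) :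
    Summable fun i : ℕ => hypergeometric0F1Coeff a i * z ^ i := by
  refine Summable.of_norm_bounded (Real.summable_pow_div_factorial (a⁻¹ * |z|)) fun i => ?_
  rw [norm_mul, norm_pow, Real.norm_of_nonneg (hypergeometric0F1Coeff_pos ha i).le,
    Real.norm_eq_abs, mul_pow, mul_div_right_comm]
  gcongr
  exact hypergeometric0F1Coeff_le ha i

theorem continuous_hypergeometric0F1 {a : ℝ} (ha : 0 < a) : Continuous (hypergeometric0F1 a) := by
  refine continuous_iff_continuousAt.2 fun z => ?_
  have hball : ContinuousOn (hypergeometric0F1 a) (Metric.ball 0 (|z| + 1)) := by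
    refine continuousOn_tsum (fun i => by fun_prop)
      (summable_hypergeometric0F1 ha (|z| + 1)) fun i x hx => ?_
    rw [norm_mul, norm_pow, Real.norm_of_nonneg (hypergeometric0F1Coeff_pos ha i).le]
    have := (hypergeometric0F1Coeff_pos ha i).le
    gcongr
    exact (mem_ball_zero_iff.1 hx).le
  exact hball.continuousAt (Metric.isOpen_ball.mem_nhds (by simp))

theorem Gamma_nat_add_half_mul_factorial (i : ℕ) :
    Real.Gamma (i + 1 / 2) * i.factorial * 4 ^ i = (2 * i).factorial * Real.Gamma (1 / 2) := by
  induction i with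
  | zero => simp
  | succ i ih =>
    have hrec : Real.Gamma ((i + 1 : ℕ) + 1 / 2) = (i + 1 / 2) * Real.Gamma (i + 1 / 2) := by
      rw [← Real.Gamma_add_one (by positivity)]
      push_cast
      ring_nf
    rw [hrec, show 2 * (i + 1) = 2 * i + 1 + 1 by ring, Nat.factorial_succ, Nat.factorial_succ,
      Nat.factorial_succ, pow_succ]
    push_cast
    linear_combination (4 * (i + 1 / 2) * (i + 1) : ℝ) * ih

theorem hypergeometric0F1_half (s : ℝ) :
    hypergeometric0F1 (1 / 2) (-(s ^ 2) / 4) = Real.cos s := by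
  rw [Real.cos_eq_tsum]
  refine tsum_congr fun i => ?_
  have hΓ := Gamma_nat_add_half_mul_factorial i
  have : 0 < Real.Gamma (i + 1 / 2) := Real.Gamma_pos_of_pos (by positivity)
  rw [hypergeometric0F1Coeff, div_pow, neg_pow, ← pow_mul, div_mul_div_comm,
    div_eq_div_iff (by positivity) (by positivity)]
  linear_combination (-(-1) ^ i * s ^ (2 * i) : ℝ) * hΓ

theorem integral_hypergeometric0F1_mul {a : ℝ} (ha : 0 < a) (z : ℝ) {μ : Measure ℝ}
    (hμ : ∀ᵐ x ∂μ, 0 ≤ x) {M : ℕ → ℝ} (hM : ∀ i, 0 ≤ M i)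
    (hmoment : ∀ i : ℕ, ∫⁻ x, ENNReal.ofReal (x ^ i) ∂μ = ENNReal.ofReal (M i))
    (hsum : Summable fun i => hypergeometric0F1Coeff a i * |z| ^ i * M i) :
    ∫ x, hypergeometric0F1 a (z * x) ∂μ = ∑' i, hypergeometric0F1Coeff a i * z ^ i * M i := by
  have hpow (i : ℕ) : ∀ᵐ x ∂μ, 0 ≤ x ^ i := hμ.mono fun x hx => pow_nonneg hx i
  have hmeas (i : ℕ) : AEStronglyMeasurable (fun x : ℝ => x ^ i) μ :=
    (continuous_pow i).aestronglyMeasurable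
  have hint (i : ℕ) : Integrable (fun x : ℝ => x ^ i) μ :=
    ⟨hmeas i, (hasFiniteIntegral_iff_ofReal (hpow i)).2 (hmoment i ▸ ENNReal.ofReal_lt_top)⟩
  have hintegral (i : ℕ) : ∫ x, x ^ i ∂μ = M i := by
    rw [integral_eq_lintegral_of_nonneg_ae (hpow i) (hmeas i), hmoment,
      ENNReal.toReal_ofReal (hM i)]
  have hnorm (i : ℕ) : ∫ x, ‖hypergeometric0F1Coeff a i * z ^ i * x ^ i‖ ∂μ =
      hypergeometric0F1Coeff a i * |z| ^ i * M i := by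
    rw [← hintegral, ← integral_const_mul]
    refine integral_congr_ae ((hpow i).mono fun x hx => ?_)
    simp only [norm_mul, norm_pow, Real.norm_of_nonneg (hypergeometric0F1Coeff_pos ha i).le,
      Real.norm_eq_abs, ← abs_pow x, abs_of_nonneg hx]
  have hswap := hasSum_integral_of_summable_integral_norm
    (fun i => (hint i).const_mul (hypergeometric0F1Coeff a i * z ^ i)) (by simpa only [hnorm])
  simp only [integral_const_mul, hintegral] at hswap
  rw [hswap.tsum_eq]
  simp only [hypergeometric0F1, mul_pow, mul_assoc]

/-! ### Averages over beta and gamma laws -/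

theorem measurable_betaPDF (a b : ℝ) : Measurable (betaPDF a b) :=
  (measurable_betaPDFReal a b).ennreal_ofReal

theorem ae_mem_Ioo_betaMeasure (a b : ℝ) : ∀ᵐ x ∂betaMeasure a b, x ∈ Ioo (0 : ℝ) 1 := by
  rw [betaMeasure, ae_withDensity_iff (measurable_betaPDF a b)]
  refine ae_of_all _ fun x hx => ?_
  by_contra hx'
  exact hx (by rw [betaPDF_eq, if_neg (by simpa using hx'), ENNReal.ofReal_zero])

theorem ofReal_pow_mul_betaPDF {a b : ℝ} (ha : 0 < a) (hb : 0 < b) (i : ℕ) (x : ℝ) :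
    ENNReal.ofReal (x ^ i) * betaPDF a b x =
      ENNReal.ofReal (beta (a + i) b / beta a b) * betaPDF (a + i) b x := by
  have := beta_pos ha hb
  have := beta_pos (by positivity : 0 < a + i) hb
  simp only [betaPDF_eq]
  split_ifs with hx
  · have hx0 := hx.1
    rw [← ENNReal.ofReal_mul (by positivity), ← ENNReal.ofReal_mul (by positivity),
      show a + i - 1 = a - 1 + i by ring, Real.rpow_add_natCast hx0.ne']
    congr 1
    field_simp
  · simp

theorem lintegral_pow_betaMeasure {a b : ℝ} (ha : 0 < a) (hb : 0 < b) (i : ℕ) :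
    ∫⁻ x, ENNReal.ofReal (x ^ i) ∂betaMeasure a b =
      ENNReal.ofReal (beta (a + i) b / beta a b) := by
  rw [betaMeasure, lintegral_withDensity_eq_lintegral_mul _ (measurable_betaPDF a b) (by fun_prop)]
  simp only [Pi.mul_apply, mul_comm (betaPDF a b _), ofReal_pow_mul_betaPDF ha hb]
  rw [lintegral_const_mul _ (measurable_betaPDF _ b), lintegral_betaPDF_eq_one (by positivity) hb,
    mul_one]

/-- Sonine's first finite integral. -/
theorem integral_hypergeometric0F1_betaMeasure {a b : ℝ} (ha : 0 < a) (hb : 0 < b) (z : ℝ) :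
    ∫ x, hypergeometric0F1 a (z * x) ∂betaMeasure a b = hypergeometric0F1 (a + b) z := by
  have hcoeff (i : ℕ) (w : ℝ) :
      hypergeometric0F1Coeff a i * w * (beta (a + i) b / beta a b) =
        hypergeometric0F1Coeff (a + b) i * w := by
    have := Real.Gamma_pos_of_pos ha
    have := Real.Gamma_pos_of_pos hb
    have := Real.Gamma_pos_of_pos (add_pos ha hb)
    have : 0 < Real.Gamma (i + a) := Real.Gamma_pos_of_pos (by positivity)
    have : 0 < Real.Gamma (i + (a + b)) := Real.Gamma_pos_of_pos (by positivity)
    simp only [beta, hypergeometric0F1Coeff, add_comm a (i : ℝ), add_assoc]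
    field_simp
  rw [integral_hypergeometric0F1_mul ha z ((ae_mem_Ioo_betaMeasure a b).mono fun x hx => hx.1.le)
    (fun i => (div_pos (beta_pos (by positivity) hb) (beta_pos ha hb)).le)
    (lintegral_pow_betaMeasure ha hb)]
  · simp only [hcoeff, hypergeometric0F1]
  · simpa only [hcoeff] using summable_hypergeometric0F1 (add_pos ha hb) |z|

theorem abs_hypergeometric0F1_le_one {a z : ℝ} (ha : 1 / 2 ≤ a) (hz : z ≤ 0) :
    |hypergeometric0F1 a z| ≤ 1 := by
  have hhalf : ∀ z ≤ 0, |hypergeometric0F1 (1 / 2) z| ≤ 1 := fun z hz => by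
    rw [show z = -(√(-(4 * z)) ^ 2) / 4 by rw [Real.sq_sqrt (by linarith)]; ring,
      hypergeometric0F1_half]
    exact Real.abs_cos_le_one _
  rcases ha.eq_or_lt with rfl | ha
  · exact hhalf z hz
  · have := isProbabilityMeasureBeta (by norm_num : (0 : ℝ) < 1 / 2) (sub_pos.2 ha)
    rw [← add_sub_cancel (1 / 2) a, ← integral_hypergeometric0F1_betaMeasure (by norm_num)
      (sub_pos.2 ha)]
    have hbound : ∀ᵐ x ∂betaMeasure (1 / 2) (a - 1 / 2),
        ‖hypergeometric0F1 (1 / 2) (z * x)‖ ≤ 1 := by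
      filter_upwards [ae_mem_Ioo_betaMeasure (1 / 2) (a - 1 / 2)] with x hx
      exact hhalf _ (mul_nonpos_of_nonpos_of_nonneg hz hx.1.le)
    exact (norm_integral_le_of_norm_le_const hbound).trans_eq (by rw [probReal_univ, mul_one])

theorem measurable_gammaPDF (a r : ℝ) : Measurable (gammaPDF a r) :=
  (measurable_gammaPDFReal a r).ennreal_ofReal

theorem ae_nonneg_gammaMeasure (a r : ℝ) : ∀ᵐ x ∂gammaMeasure a r, 0 ≤ x := by
  rw [gammaMeasure, ae_withDensity_iff (measurable_gammaPDF a r)]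
  refine ae_of_all _ fun x hx => ?_
  by_contra hx'
  exact hx (by rw [gammaPDF_eq, if_neg hx', ENNReal.ofReal_zero])

theorem ofReal_pow_mul_gammaPDF {a r x : ℝ} (ha : 0 < a) (hr : 0 < r) (hx : x ≠ 0) (i : ℕ) :
    ENNReal.ofReal (x ^ i) * gammaPDF a r x =
      ENNReal.ofReal (Real.Gamma (a + i) / (Real.Gamma a * r ^ i)) * gammaPDF (a + i) r x := by
  have := Real.Gamma_pos_of_pos ha
  have : 0 < Real.Gamma (a + i) := Real.Gamma_pos_of_pos (by positivity)
  simp only [gammaPDF_eq]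
  split_ifs with hx0
  · rw [← ENNReal.ofReal_mul (by positivity), ← ENNReal.ofReal_mul (by positivity),
      show a + i - 1 = a - 1 + i by ring, Real.rpow_add_natCast hx, Real.rpow_add_natCast hr.ne']
    congr 1
    field_simp
  · simp

theorem lintegral_pow_gammaMeasure {a r : ℝ} (ha : 0 < a) (hr : 0 < r) (i : ℕ) :
    ∫⁻ x, ENNReal.ofReal (x ^ i) ∂gammaMeasure a r =
      ENNReal.ofReal (Real.Gamma (a + i) / (Real.Gamma a * r ^ i)) := by
  rw [gammaMeasure,
    lintegral_withDensity_eq_lintegral_mul _ (measurable_gammaPDF a r) (by fun_prop),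
    ← mul_one (ENNReal.ofReal (_ / _)),
    ← lintegral_gammaPDF_eq_one (by positivity : 0 < a + i) hr,
    ← lintegral_const_mul _ (measurable_gammaPDF _ r)]
  refine lintegral_congr_ae ?_
  filter_upwards [Measure.ae_ne volume 0] with x hx
  rw [Pi.mul_apply, mul_comm, ofReal_pow_mul_gammaPDF ha hr hx]

/-- Weber's first exponential integral. -/
theorem integral_hypergeometric0F1_gammaMeasure {a r : ℝ} (ha : 0 < a) (hr : 0 < r) (z : ℝ) :
    ∫ x, hypergeometric0F1 a (z * x) ∂gammaMeasure a r = Real.exp (z / r) := by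
  have hcoeff (i : ℕ) (w : ℝ) :
      hypergeometric0F1Coeff a i * w ^ i * (Real.Gamma (a + i) / (Real.Gamma a * r ^ i)) =
        (w / r) ^ i / i.factorial := by
    have := Real.Gamma_pos_of_pos ha
    have : 0 < Real.Gamma (i + a) := Real.Gamma_pos_of_pos (by positivity)
    simp only [hypergeometric0F1Coeff, add_comm a (i : ℝ), div_pow]
    field_simp
  rw [integral_hypergeometric0F1_mul ha z (ae_nonneg_gammaMeasure a r) (fun i => ?_)
    (lintegral_pow_gammaMeasure ha hr)]
  · simp only [hcoeff, Real.exp_eq_exp_ℝ, NormedSpace.exp_eq_tsum_div]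
  · simpa only [hcoeff] using Real.summable_pow_div_factorial (|z| / r)
  · have := Real.Gamma_pos_of_pos ha
    have : 0 < Real.Gamma (a + i) := Real.Gamma_pos_of_pos (by positivity)
    positivity

/-! ### Uniqueness of the representing measure -/

open scoped BoundedContinuousFunction in
theorem ext_of_integral_pow_eq {E : Type*} [TopologicalSpace E] [PolishSpace E]
    [MeasurableSpace E] [BorelSpace E] {μ ν : Measure E} [IsFiniteMeasure μ] [IsFiniteMeasure ν]
    {g : E →ᵇ ℝ} (hg : Function.Injective g)
    (h : ∀ n : ℕ, ∫ x, g x ^ n ∂μ = ∫ x, g x ^ n ∂ν) : μ = ν := by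
  let polynomialsInG : StarSubalgebra ℝ (E →ᵇ ℝ) :=
    { (Polynomial.aeval (R := ℝ) g).range with
      star_mem' := fun {f} hf => by
        rwa [show star f = f from BoundedContinuousFunction.ext fun x => star_trivial (f x)] }
  refine ext_of_forall_mem_subalgebra_integral_eq_of_polish (A := polynomialsInG) ?_ ?_
  · intro x y hxy
    exact ⟨g, ⟨g, ⟨g, ⟨Polynomial.X, Polynomial.aeval_X g⟩, rfl⟩, rfl⟩, fun hgxy => hxy (hg hgxy)⟩
  · rintro _ ⟨p, rfl⟩
    induction p using Polynomial.induction_on' with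
    | add p q hp hq =>
      simp only [AlgHom.toRingHom_eq_coe, RingHom.coe_coe, map_add,
        BoundedContinuousFunction.coe_add, Pi.add_apply] at hp hq ⊢
      rw [integral_add (BoundedContinuousFunction.integrable _ _)
        (BoundedContinuousFunction.integrable _ _), integral_add
        (BoundedContinuousFunction.integrable _ _) (BoundedContinuousFunction.integrable _ _),
        hp, hq]
    | monomial n c =>
      simp [Polynomial.aeval_monomial, Algebra.algebraMap_eq_smul_one, integral_const_mul, h]

theorem map_coe_map_toNNReal {μ : Measure ℝ} (hμ : μ (Iio 0) = 0) :
    (μ.map Real.toNNReal).map (fun t : NNReal => (t : ℝ)) = μ := by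
  rw [Measure.map_map (by fun_prop) (by fun_prop)]
  refine (Measure.map_congr ?_).trans Measure.map_id
  filter_upwards [measure_eq_zero_iff_ae_notMem.1 hμ] with t ht
  exact Real.coe_toNNReal t (not_lt.1 ht)

theorem ext_of_integral_exp_neg_mul_sq_eq {μ ν : Measure ℝ} [IsFiniteMeasure μ]
    [IsFiniteMeasure ν] (hμ : μ (Iio 0) = 0) (hν : ν (Iio 0) = 0)
    (h : ∀ n : ℕ, ∫ t, Real.exp (-(n * t ^ 2)) ∂μ = ∫ t, Real.exp (-(n * t ^ 2)) ∂ν) :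
    μ = ν := by
  let g : BoundedContinuousFunction NNReal ℝ :=
    .ofNormedAddCommGroup (fun t => Real.exp (-(t : ℝ) ^ 2)) (by fun_prop) 1 fun t => by
      rw [Real.norm_of_nonneg (Real.exp_pos _).le, Real.exp_le_one_iff]
      exact neg_nonpos.2 (sq_nonneg _)
  have hg : Function.Injective g := fun s t hst => by
    have hsq : (s : ℝ) ^ 2 = t ^ 2 := neg_injective (Real.exp_injective hst)
    exact NNReal.coe_injective ((pow_left_inj₀ s.2 t.2 two_ne_zero).1 hsq)
  have hpow {κ : Measure ℝ} (hκ : κ (Iio 0) = 0) (n : ℕ) :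
      ∫ t, g t ^ n ∂(κ.map Real.toNNReal) = ∫ t, Real.exp (-(n * t ^ 2)) ∂κ := by
    conv_rhs => rw [← map_coe_map_toNNReal hκ]
    rw [integral_map (φ := ((↑) : NNReal → ℝ)) (by fun_prop) (by fun_prop)]
    refine integral_congr_ae (ae_of_all _ fun t => ?_)
    change Real.exp (-(t : ℝ) ^ 2) ^ n = _
    rw [← Real.exp_nat_mul, mul_neg]
  have hmap : μ.map Real.toNNReal = ν.map Real.toNNReal :=
    ext_of_integral_pow_eq hg fun n => by rw [hpow hμ, hpow hν, h]
  rw [← map_coe_map_toNNReal hμ, ← map_coe_map_toNNReal hν, hmap]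

theorem integral_integral_hypergeometric0F1_gammaMeasure {a : ℝ} (ha : 1 / 2 ≤ a) {r c : ℝ}
    (hr : 0 < r) (hc : 0 ≤ c) (μ : Measure ℝ) [IsFiniteMeasure μ] :
    ∫ s, ∫ t, hypergeometric0F1 a (-(c * s * t ^ 2)) ∂μ ∂gammaMeasure a r =
      ∫ t, Real.exp (-(c * t ^ 2) / r) ∂μ := by
  have ha0 : 0 < a := by linarith
  have := isProbabilityMeasure_gammaMeasure ha0 hr
  rw [integral_integral_swap]
  · refine integral_congr_ae (ae_of_all _ fun t => ?_)
    simp only [← integral_hypergeometric0F1_gammaMeasure ha0 hr, neg_mul, mul_right_comm c]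
  · refine Integrable.of_bound ((continuous_hypergeometric0F1 ha0).comp
      (by fun_prop)).aestronglyMeasurable 1 ?_
    have hs : ∀ᵐ z ∂(gammaMeasure a r).prod μ, 0 ≤ z.1 :=
      Measure.quasiMeasurePreserving_fst.ae (ae_nonneg_gammaMeasure a r)
    filter_upwards [hs] with z hz
    exact abs_hypergeometric0F1_le_one ha (neg_nonpos.2 (by positivity))

theorem ext_of_integral_hypergeometric0F1_eq {a : ℝ} (ha : 1 / 2 ≤ a) {μ ν : Measure ℝ}
    [IsFiniteMeasure μ] [IsFiniteMeasure ν] (hμ : μ (Iio 0) = 0) (hν : ν (Iio 0) = 0)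
    (h : ∀ s : ℝ, 0 ≤ s → ∫ t, hypergeometric0F1 a (-(s * t ^ 2)) ∂μ =
      ∫ t, hypergeometric0F1 a (-(s * t ^ 2)) ∂ν) : μ = ν := by
  refine ext_of_integral_exp_neg_mul_sq_eq hμ hν fun n => ?_
  have hexp (κ : Measure ℝ) [IsFiniteMeasure κ] := integral_integral_hypergeometric0F1_gammaMeasure
    ha one_pos n.cast_nonneg κ
  simp only [div_one] at hexp
  rw [← hexp, ← hexp]
  refine integral_congr_ae ((ae_nonneg_gammaMeasure a 1).mono fun s hs => ?_)
  exact h _ (by positivity)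

/-! ### The transition formula -/

section IteratedIntegrals

variable {ν : Measure ℝ} [SFinite ν] {F : ℝ → ℝ → ENNReal}

theorem measurable_lintegral_Ioi (hF : Measurable (Function.uncurry F)) :
    Measurable fun x => ∫⁻ u in Ioi x, F x u ∂ν := by
  simp only [← lintegral_indicator measurableSet_Ioi]
  exact (hF.indicator (measurableSet_lt measurable_fst measurable_snd)).lintegral_prod_right'

theorem setLIntegral_Ioi_lintegral_Ioi_swap {μ : Measure ℝ} [SFinite μ]
    (hF : Measurable (Function.uncurry F)) (c : ℝ) :
    ∫⁻ x in Ioi c, ∫⁻ u in Ioi x, F x u ∂ν ∂μ =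
      ∫⁻ u in Ioi c, ∫⁻ x in Ioo c u, F x u ∂μ ∂ν := by
  let G : ℝ × ℝ → ENNReal := {z : ℝ × ℝ | z.1 < z.2}.indicator (Function.uncurry F)
  have hG : Measurable G := hF.indicator (measurableSet_lt measurable_fst measurable_snd)
  calc ∫⁻ x in Ioi c, ∫⁻ u in Ioi x, F x u ∂ν ∂μ
      = ∫⁻ x in Ioi c, ∫⁻ u in Ioi c, G (x, u) ∂ν ∂μ := by
        refine setLIntegral_congr_fun measurableSet_Ioi fun x hx => ?_
        change ∫⁻ u in Ioi x, F x u ∂ν = ∫⁻ u in Ioi c, (Ioi x).indicator (F x) u ∂ν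
        rw [setLIntegral_indicator measurableSet_Ioi,
          inter_eq_left.2 (Ioi_subset_Ioi (le_of_lt hx))]
    _ = ∫⁻ u in Ioi c, ∫⁻ x in Ioi c, G (x, u) ∂μ ∂ν :=
        lintegral_lintegral_swap hG.aemeasurable
    _ = ∫⁻ u in Ioi c, ∫⁻ x in Ioo c u, F x u ∂μ ∂ν := by
        refine lintegral_congr fun u => ?_
        change ∫⁻ x in Ioi c, (Iio u).indicator (fun x => F x u) x ∂μ = _
        rw [setLIntegral_indicator measurableSet_Iio, Iio_inter_Ioi]

end IteratedIntegrals

theorem image_sq_div_sq_Ioo {u : ℝ} (hu : 0 < u) :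
    (fun x : ℝ => x ^ 2 / u ^ 2) '' Ioo 0 u = Ioo 0 1 := by
  ext b
  constructor
  · rintro ⟨x, ⟨hx0, hxu⟩, rfl⟩
    exact ⟨by positivity, (div_lt_one (by positivity)).2 (by gcongr)⟩
  · rintro ⟨hb0, hb1⟩
    have hsqrt : √b < 1 := by rwa [Real.sqrt_lt' one_pos, one_pow]
    refine ⟨u * √b, ⟨by positivity, mul_lt_of_lt_one_right hu hsqrt⟩, ?_⟩
    simp only [mul_pow, Real.sq_sqrt hb0.le]
    field_simp

theorem setLIntegral_mul_comp_mul_sqrt {u : ℝ} (hu : 0 < u) (ρ g : ℝ → ENNReal) :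
    ∫⁻ b in Ioo (0 : ℝ) 1, ρ b * g (u * √b) =
      ∫⁻ x in Ioo 0 u, ENNReal.ofReal (2 * x / u ^ 2) * ρ (x ^ 2 / u ^ 2) * g x := by
  have hderiv (x : ℝ) : HasDerivAt (fun x : ℝ => x ^ 2 / u ^ 2) (2 * x / u ^ 2) x := by
    simpa using (hasDerivAt_pow 2 x).div_const (u ^ 2)
  have hinj : InjOn (fun x : ℝ => x ^ 2 / u ^ 2) (Ioo 0 u) := fun x hx y hy hxy =>
    (pow_left_inj₀ hx.1.le hy.1.le two_ne_zero).1 ((div_left_inj' (by positivity)).1 hxy)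
  rw [← image_sq_div_sq_Ioo hu, lintegral_image_eq_lintegral_abs_deriv_mul measurableSet_Ioo
    (fun x _ => (hderiv x).hasDerivWithinAt) hinj]
  refine setLIntegral_congr_fun measurableSet_Ioo fun x ⟨hx0, _⟩ => ?_
  have hsqrt : u * √(x ^ 2 / u ^ 2) = x := by
    rw [← div_pow, Real.sqrt_sq (by positivity), mul_div_cancel₀ _ hu.ne']
  simp only [hsqrt, abs_of_nonneg (by positivity : 0 ≤ 2 * x / u ^ 2), mul_assoc]

theorem lintegral_comp_mul_sqrt_betaMeasure (a b : ℝ) {u : ℝ} (hu : 0 < u) {g : ℝ → ENNReal}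
    (hg : Measurable g) :
    ∫⁻ y, g (u * √y) ∂betaMeasure a b =
      ∫⁻ x in Ioo 0 u, ENNReal.ofReal (2 * x / u ^ 2) * betaPDF a b (x ^ 2 / u ^ 2) * g x := by
  rw [← setLIntegral_mul_comp_mul_sqrt hu, betaMeasure,
    lintegral_withDensity_eq_lintegral_mul _ (measurable_betaPDF a b) (by fun_prop),
    setLIntegral_eq_of_support_subset]
  · rfl
  · intro y hy
    by_contra hy'
    exact left_ne_zero_of_mul hy
      (by rw [betaPDF_eq, if_neg (by simpa using hy'), ENNReal.ofReal_zero])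

/-- The law of `U √B`, where `U` has law `ν` and `B` is an independent variable with the beta law
of parameters `a` and `b`. -/
def sqrtBetaMixture (a b : ℝ) (ν : Measure ℝ) : Measure ℝ :=
  (ν.prod (betaMeasure a b)).map fun z : ℝ × ℝ => z.1 * √z.2

theorem measurable_mul_sqrt : Measurable fun z : ℝ × ℝ => z.1 * √z.2 := by
  fun_prop

section SqrtBetaMixture

variable {a b : ℝ} {ν : Measure ℝ}

theorem isFiniteMeasure_sqrtBetaMixture (ha : 0 < a) (hb : 0 < b) [IsFiniteMeasure ν] :
    IsFiniteMeasure (sqrtBetaMixture a b ν) := by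
  have := isProbabilityMeasureBeta ha hb
  unfold sqrtBetaMixture
  infer_instance

theorem sqrtBetaMixture_Iio_zero (ha : 0 < a) (hb : 0 < b) (hν : ν (Iio 0) = 0) :
    sqrtBetaMixture a b ν (Iio 0) = 0 := by
  have := isProbabilityMeasureBeta ha hb
  rw [sqrtBetaMixture, Measure.map_apply measurable_mul_sqrt measurableSet_Iio]
  refine measure_mono_null (t := Iio 0 ×ˢ univ) (fun z hz => ⟨?_, mem_univ _⟩) (by simp [hν])
  exact neg_of_mul_neg_left hz (Real.sqrt_nonneg _)

theorem restrict_Ioi_sqrtBetaMixture (ha : 0 < a) (hb : 0 < b) [SFinite ν] :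
    (sqrtBetaMixture a b ν).restrict (Ioi 0) =
      (volume.restrict (Ioi 0)).withDensity fun x => ∫⁻ u in Ioi x,
        ENNReal.ofReal (2 * x / u ^ 2) * betaPDF a b (x ^ 2 / u ^ 2) ∂ν := by
  have := isProbabilityMeasureBeta ha hb
  let K (x u : ℝ) : ENNReal := ENNReal.ofReal (2 * x / u ^ 2) * betaPDF a b (x ^ 2 / u ^ 2)
  have hK : Measurable (Function.uncurry K) :=
    .mul (by fun_prop) ((measurable_betaPDF a b).comp (by fun_prop))
  refine Measure.ext_of_lintegral _ fun g hg => ?_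
  let g₀ : ℝ → ENNReal := (Ioi 0).indicator g
  have hg₀ : Measurable g₀ := hg.indicator measurableSet_Ioi
  have hg₀_nonpos {u : ℝ} (hu : u ≤ 0) (y : ℝ) : g₀ (u * √y) = 0 :=
    indicator_of_notMem (not_lt.2 (mul_nonpos_of_nonpos_of_nonneg hu (Real.sqrt_nonneg y))) g
  calc ∫⁻ x in Ioi 0, g x ∂sqrtBetaMixture a b ν
      = ∫⁻ u, ∫⁻ y, g₀ (u * √y) ∂betaMeasure a b ∂ν := by
        rw [← lintegral_indicator measurableSet_Ioi, sqrtBetaMixture,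
          lintegral_map hg₀ measurable_mul_sqrt, lintegral_prod]
        exact (hg₀.comp measurable_mul_sqrt).aemeasurable
    _ = ∫⁻ u in Ioi 0, ∫⁻ y, g₀ (u * √y) ∂betaMeasure a b ∂ν := by
        refine (setLIntegral_eq_of_support_subset fun u hu => ?_).symm
        by_contra hu'
        exact hu (by simp only [hg₀_nonpos (not_lt.1 hu'), lintegral_zero])
    _ = ∫⁻ u in Ioi 0, ∫⁻ x in Ioo 0 u, K x u * g x ∂volume ∂ν := by
        refine setLIntegral_congr_fun measurableSet_Ioi fun u hu => ?_
        simp only [lintegral_comp_mul_sqrt_betaMeasure a b hu hg₀]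
        refine setLIntegral_congr_fun measurableSet_Ioo fun x hx => ?_
        simp only [K, g₀, indicator_of_mem (show x ∈ Ioi 0 from hx.1)]
    _ = ∫⁻ x in Ioi 0, ∫⁻ u in Ioi x, K x u * g x ∂ν :=
        (setLIntegral_Ioi_lintegral_Ioi_swap (F := fun x u => K x u * g x)
          (hK.mul (hg.comp measurable_fst)) 0).symm
    _ = ∫⁻ x in Ioi 0, (∫⁻ u in Ioi x, K x u ∂ν) * g x :=
        lintegral_congr fun x => lintegral_mul_const _ hK.of_uncurry_left
    _ = ∫⁻ x, g x ∂(volume.restrict (Ioi 0)).withDensity fun x => ∫⁻ u in Ioi x, K x u ∂ν :=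
        (lintegral_withDensity_eq_lintegral_mul _ (measurable_lintegral_Ioi hK) hg).symm

theorem integral_hypergeometric0F1_sqrtBetaMixture (ha : 1 / 2 ≤ a) (hb : 0 < b)
    [IsFiniteMeasure ν] {s : ℝ} (hs : 0 ≤ s) :
    ∫ t, hypergeometric0F1 a (-(s * t ^ 2)) ∂sqrtBetaMixture a b ν =
      ∫ u, hypergeometric0F1 (a + b) (-(s * u ^ 2)) ∂ν := by
  have ha0 : 0 < a := by linarith
  have := isProbabilityMeasureBeta ha0 hb
  have hcont : Continuous fun t : ℝ => hypergeometric0F1 a (-(s * t ^ 2)) :=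
    (continuous_hypergeometric0F1 ha0).comp (by fun_prop)
  rw [sqrtBetaMixture, integral_map measurable_mul_sqrt.aemeasurable hcont.aestronglyMeasurable,
    integral_prod]
  · refine integral_congr_ae (ae_of_all _ fun u => ?_)
    simp only [← integral_hypergeometric0F1_betaMeasure ha0 hb]
    refine integral_congr_ae ((ae_mem_Ioo_betaMeasure a b).mono fun y hy => ?_)
    simp only [mul_pow, Real.sq_sqrt hy.1.le, neg_mul, mul_assoc]
  · refine Integrable.of_bound
      (hcont.measurable.comp measurable_mul_sqrt).aestronglyMeasurable 1 (ae_of_all _ fun z => ?_)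
    exact abs_hypergeometric0F1_le_one ha (neg_nonpos.2 (by positivity))

end SqrtBetaMixture

theorem IsSchoenbergMeasure.eq_sqrtBetaMixture {m j : ℕ} (hm : 1 ≤ m) (hj : 1 ≤ j) {f : ℝ → ℝ}
    {νm ν : Measure ℝ} (hνm : IsSchoenbergMeasure m f νm)
    (hν : IsSchoenbergMeasure (m + 2 * j) f ν) : νm = sqrtBetaMixture (m / 2) j ν := by
  have := hνm.finite
  have := hν.finite
  have hm2 : (1 / 2 : ℝ) ≤ m / 2 := by gcongr; exact_mod_cast hm
  have hm0 : (0 : ℝ) < m / 2 := by linarith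
  have hj0 : (0 : ℝ) < j := by exact_mod_cast hj
  have := isFiniteMeasure_sqrtBetaMixture hm0 hj0 (ν := ν)
  refine ext_of_integral_hypergeometric0F1_eq hm2 hνm.support
    (sqrtBetaMixture_Iio_zero hm0 hj0 hν.support) fun s hs => ?_
  have hΩ (n : ℕ) (t : ℝ) : schoenbergKernel n (√(4 * s) * t) =
      hypergeometric0F1 (n / 2) (-(s * t ^ 2)) := by
    rw [schoenbergKernel_eq_hypergeometric0F1, mul_pow, Real.sq_sqrt (by positivity)]
    ring_nf
  have hf := (hνm.repr _ (Real.sqrt_nonneg (4 * s))).symm.trans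
    (hν.repr _ (Real.sqrt_nonneg (4 * s)))
  simp only [hΩ] at hf
  rw [hf, integral_hypergeometric0F1_sqrtBetaMixture hm2 hj0 hs]
  push_cast
  ring_nf

theorem two_mul_div_sq_mul_betaPDFReal_half {m j : ℕ} (hm : 1 ≤ m) (hj : 1 ≤ j) {x u : ℝ}
    (hx : 0 < x) (hu : x < u) :
    2 * x / u ^ 2 * betaPDFReal (m / 2) j (x ^ 2 / u ^ 2) =
      2 * x ^ (m - 1) / beta (m / 2) j * ((1 - x ^ 2 / u ^ 2) ^ (j - 1) / u ^ m) := by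
  have hu0 : 0 < u := hx.trans hu
  have hxu : x ^ 2 / u ^ 2 < 1 := (div_lt_one (by positivity)).2 (by gcongr)
  obtain ⟨l, rfl⟩ := Nat.exists_eq_add_of_le' hm
  obtain ⟨k, rfl⟩ := Nat.exists_eq_add_of_le' hj
  have hpow_m : (x ^ 2 / u ^ 2) ^ (((l + 1 : ℕ) : ℝ) / 2 - 1) = (x / u) ^ l * (x / u)⁻¹ := by
    rw [← div_pow, ← Real.rpow_natCast (x / u) 2, ← Real.rpow_mul (by positivity),
      ← Real.rpow_natCast (x / u) l, ← Real.rpow_neg_one, ← Real.rpow_add (by positivity)]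
    congr 1
    push_cast
    ring
  have hpow_j : (1 - x ^ 2 / u ^ 2) ^ (((k + 1 : ℕ) : ℝ) - 1) = (1 - x ^ 2 / u ^ 2) ^ k := by
    rw [Nat.cast_succ, add_sub_cancel_right, Real.rpow_natCast]
  rw [betaPDFReal, if_pos ⟨by positivity, hxu⟩, hpow_m, hpow_j]
  simp only [Nat.add_sub_cancel, div_pow x u l, pow_succ u l]
  field_simp

theorem ofReal_transitionDensity {m j : ℕ} (hm : 1 ≤ m) (hj : 1 ≤ j) (ν : Measure ℝ)
    [IsFiniteMeasure ν] {x : ℝ} (hx : 0 < x) :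
    ENNReal.ofReal (transitionDensity m j ν x) =
      ∫⁻ u in Ioi x, ENNReal.ofReal (2 * x / u ^ 2) * betaPDF (m / 2) j (x ^ 2 / u ^ 2) ∂ν := by
  have hm0 : (0 : ℝ) < m := by exact_mod_cast hm
  have hB := beta_pos (half_pos hm0) (by exact_mod_cast hj : (0 : ℝ) < j)
  have hfac {u : ℝ} (hu : x < u) : 0 ≤ 1 - x ^ 2 / u ^ 2 ∧ 1 - x ^ 2 / u ^ 2 ≤ 1 := by
    have hu0 : 0 < u := hx.trans hu
    exact ⟨sub_nonneg.2 ((div_le_one (by positivity)).2 (by gcongr)),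
      sub_le_self _ (by positivity)⟩
  rw [transitionDensity, ← integral_const_mul, ofReal_integral_eq_lintegral_ofReal]
  · refine setLIntegral_congr_fun measurableSet_Ioi fun u hu => ?_
    have hu0 : 0 < u := hx.trans hu
    simp only [betaPDF, ← ENNReal.ofReal_mul (by positivity : 0 ≤ 2 * x / u ^ 2),
      two_mul_div_sq_mul_betaPDFReal_half hm hj hx hu]
  · refine (Integrable.of_bound (C := 1 / x ^ m) ?_ ?_).const_mul _
    · exact (by fun_prop : Measurable fun u : ℝ =>
        (1 - x ^ 2 / u ^ 2) ^ (j - 1) / u ^ m).aestronglyMeasurable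
    · refine (ae_restrict_mem measurableSet_Ioi).mono fun u (hu : x < u) => ?_
      obtain ⟨h0, h1⟩ := hfac hu
      have hu0 : 0 < u := hx.trans hu
      rw [Real.norm_of_nonneg (by positivity)]
      gcongr
      exact pow_le_one₀ h0 h1
  · refine (ae_restrict_mem measurableSet_Ioi).mono fun u (hu : x < u) => ?_
    have hu0 : 0 < u := hx.trans hu
    have := (hfac hu).1
    simp only [Pi.zero_apply]
    positivity

theorem IsSchoenbergMeasure.restrict_Ioi_eq_withDensity {m j : ℕ} (hm : 1 ≤ m) (hj : 1 ≤ j)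
    {f : ℝ → ℝ} {νm ν : Measure ℝ} (hνm : IsSchoenbergMeasure m f νm)
    (hν : IsSchoenbergMeasure (m + 2 * j) f ν) :
    νm.restrict (Ioi 0) = (volume.restrict (Ioi 0)).withDensity
      (fun x => ENNReal.ofReal (transitionDensity m j ν x)) := by
  have := hν.finite
  rw [hνm.eq_sqrtBetaMixture hm hj hν,
    restrict_Ioi_sqrtBetaMixture (half_pos (Nat.cast_pos.2 hm)) (Nat.cast_pos.2 hj)]
  refine withDensity_congr_ae ((ae_restrict_mem measurableSet_Ioi).mono fun x hx => ?_)
  exact (ofReal_transitionDensity hm hj ν hx).symm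

/-! ### Tail transforms -/

/-- The kernel `P(x/u) / u^{k+1}`, cut off to `u > x`. Differentiation in `x` off the diagonal
replaces `(P, k)` by `(P', k + 1)`. -/
def tailKernel (P : Polynomial ℝ) (k : ℕ) (x u : ℝ) : ℝ :=
  if x < u then P.eval (x / u) / u ^ (k + 1) else 0

/-- The tail transform `x ↦ ∫_{(x,∞)} P(x/u) u^{-k-1} ν(du)`, of which the density of the
transition formula is the case `P = (2 / B(m/2,j)) X^{m-1} (1 - X²)^{j-1}`, `k = 0`. -/
def tailTransform (ν : Measure ℝ) (P : Polynomial ℝ) (k : ℕ) (x : ℝ) : ℝ :=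
  ∫ u, tailKernel P k x u ∂ν

section TailKernel

variable {P : Polynomial ℝ} {x u : ℝ}

theorem tailKernel_of_lt (P : Polynomial ℝ) (k : ℕ) (h : x < u) :
    tailKernel P k x u = P.eval (x / u) / u ^ (k + 1) :=
  if_pos h

theorem tailKernel_of_le (P : Polynomial ℝ) (k : ℕ) (h : u ≤ x) : tailKernel P k x u = 0 :=
  if_neg h.not_gt

theorem measurable_uncurry_tailKernel (P : Polynomial ℝ) (k : ℕ) :
    Measurable (Function.uncurry (tailKernel P k)) :=
  .ite (measurableSet_lt measurable_fst measurable_snd)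
    ((P.continuous.measurable.comp (measurable_fst.div measurable_snd)).div
      (measurable_snd.pow_const _)) measurable_const

theorem measurable_tailKernel (P : Polynomial ℝ) (k : ℕ) (x : ℝ) :
    Measurable (tailKernel P k x) :=
  (measurable_uncurry_tailKernel P k).of_uncurry_left

theorem exists_abs_eval_le_on_unitInterval (P : Polynomial ℝ) :
    ∃ C, 0 ≤ C ∧ ∀ t ∈ Icc (0 : ℝ) 1, |P.eval t| ≤ C := by
  obtain ⟨C, hC⟩ := isCompact_Icc.exists_bound_of_continuousOn
    (s := Icc (0 : ℝ) 1) P.continuous.continuousOn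
  exact ⟨C, (norm_nonneg _).trans (hC 0 (by simp)), hC⟩

theorem abs_tailKernel_le {C : ℝ} (hP : ∀ t ∈ Icc (0 : ℝ) 1, |P.eval t| ≤ C) (k : ℕ)
    (hx : 0 ≤ x) (hu : x < u) : |tailKernel P k x u| ≤ C / u ^ (k + 1) := by
  have hu0 : 0 < u := hx.trans_lt hu
  rw [tailKernel_of_lt P k hu, abs_div, abs_of_pos (pow_pos hu0 (k + 1))]
  gcongr
  exact hP _ ⟨by positivity, (div_le_one hu0).2 hu.le⟩

theorem abs_tailKernel_le_div_pow {C : ℝ} (hC : 0 ≤ C)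
    (hP : ∀ t ∈ Icc (0 : ℝ) 1, |P.eval t| ≤ C) (k : ℕ) {a : ℝ} (ha : 0 < a) (hax : a ≤ x)
    (u : ℝ) : |tailKernel P k x u| ≤ C / a ^ (k + 1) := by
  rcases lt_or_ge x u with hu | hu
  · refine (abs_tailKernel_le hP k (ha.le.trans hax) hu).trans ?_
    gcongr
    exact hax.trans hu.le
  · rw [tailKernel_of_le P k hu, abs_zero]
    positivity

theorem hasDerivAt_tailKernel (P : Polynomial ℝ) (k : ℕ) (hxu : x ≠ u) :
    HasDerivAt (fun y => tailKernel P k y u) (tailKernel P.derivative (k + 1) x u) x := by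
  rcases lt_or_gt_of_ne hxu with h | h
  · have hderiv := ((P.hasDerivAt (x / u)).comp x ((hasDerivAt_id x).div_const u)).div_const
      (u ^ (k + 1))
    rw [tailKernel_of_lt _ _ h]
    refine (hderiv.congr_deriv ?_).congr_of_eventuallyEq
      ((gt_mem_nhds h).mono fun y hy => tailKernel_of_lt P k hy)
    rw [mul_one_div, div_div, ← pow_succ' u (k + 1)]
  · rw [tailKernel_of_le _ _ h.le]
    exact (hasDerivAt_const x (0 : ℝ)).congr_of_eventuallyEq
      ((lt_mem_nhds h).mono fun y hy => tailKernel_of_le P k hy.le)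

theorem continuousAt_tailKernel (hP : P.eval 1 = 0) (k : ℕ) (hx : x ≠ 0) (u : ℝ) :
    ContinuousAt (fun y => tailKernel P k y u) x := by
  rcases ne_or_eq x u with hxu | rfl
  · exact (hasDerivAt_tailKernel P k hxu).continuousAt
  · have hcont : Continuous fun y => if x ≤ y then 0 else P.eval (y / x) / x ^ (k + 1) := by
      refine Continuous.if_le continuous_const (by fun_prop) continuous_const continuous_id ?_
      rintro y rfl
      rw [div_self hx, hP, zero_div]
    simpa only [tailKernel, ← not_le, ite_not] using hcont.continuousAt

theorem intervalIntegrable_tailKernel (P : Polynomial ℝ) (k : ℕ) {a b : ℝ} (ha : 0 < a)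
    (hab : a ≤ b) (u : ℝ) : IntervalIntegrable (fun y => tailKernel P k y u) volume a b := by
  obtain ⟨C, hC, hPC⟩ := exists_abs_eval_le_on_unitInterval P
  rw [intervalIntegrable_iff_integrableOn_Ioc_of_le hab]
  exact Measure.integrableOn_of_bounded (M := C / a ^ (k + 1)) measure_Ioc_lt_top.ne
    (measurable_uncurry_tailKernel P k).of_uncurry_right.aestronglyMeasurable
    ((ae_restrict_mem measurableSet_Ioc).mono fun x hx =>
      abs_tailKernel_le_div_pow hC hPC k ha hx.1.le u)

theorem intervalIntegral_tailKernel_derivative (hP : P.eval 1 = 0) (k : ℕ) {a b : ℝ}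
    (ha : 0 < a) (hab : a ≤ b) (u : ℝ) :
    ∫ y in a..b, tailKernel P.derivative (k + 1) y u =
      tailKernel P k b u - tailKernel P k a u :=
  integral_eq_of_hasDerivAt_off_countable_of_le (fun y => tailKernel P k y u) _ hab
    (countable_singleton u)
    (fun _ hy => (continuousAt_tailKernel hP k (ha.trans_le hy.1).ne' u).continuousWithinAt)
    (fun _ hy => hasDerivAt_tailKernel P k hy.2) (intervalIntegrable_tailKernel _ _ ha hab u)

end TailKernel

section TailTransform

variable (ν : Measure ℝ) [IsFiniteMeasure ν] {P : Polynomial ℝ} {x : ℝ}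

theorem tailTransform_eq_setIntegral (ν : Measure ℝ) (P : Polynomial ℝ) (k : ℕ) (x : ℝ) :
    tailTransform ν P k x = ∫ u in Ioi x, P.eval (x / u) / u ^ (k + 1) ∂ν :=
  integral_indicator measurableSet_Ioi

theorem measurable_tailTransform (ν : Measure ℝ) [SFinite ν] (P : Polynomial ℝ) (k : ℕ) :
    Measurable (tailTransform ν P k) :=
  (measurable_uncurry_tailKernel P k).stronglyMeasurable.integral_prod_right.measurable

theorem integrable_tailKernel (P : Polynomial ℝ) (k : ℕ) (hx : 0 < x) :
    Integrable (tailKernel P k x) ν := by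
  obtain ⟨C, hC, hPC⟩ := exists_abs_eval_le_on_unitInterval P
  exact .of_bound (measurable_tailKernel P k x).aestronglyMeasurable (C / x ^ (k + 1))
    (ae_of_all _ (abs_tailKernel_le_div_pow hC hPC k hx le_rfl))

theorem integrable_uncurry_tailKernel (P : Polynomial ℝ) (k : ℕ) {a : ℝ} (ha : 0 < a) (b : ℝ) :
    Integrable (Function.uncurry (tailKernel P k)) ((volume.restrict (Ioc a b)).prod ν) := by
  obtain ⟨C, hC, hPC⟩ := exists_abs_eval_le_on_unitInterval P
  refine .of_bound (measurable_uncurry_tailKernel P k).aestronglyMeasurable (C / a ^ (k + 1)) ?_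
  have hfst : ∀ᵐ z ∂((volume.restrict (Ioc a b)).prod ν), z.1 ∈ Ioc a b :=
    Measure.quasiMeasurePreserving_fst.ae (ae_restrict_mem measurableSet_Ioc)
  exact hfst.mono fun z hz => abs_tailKernel_le_div_pow hC hPC k ha hz.1.le z.2

theorem intervalIntegrable_tailTransform (P : Polynomial ℝ) (k : ℕ) {a b : ℝ} (ha : 0 < a)
    (hab : a ≤ b) : IntervalIntegrable (tailTransform ν P k) volume a b := by
  rw [intervalIntegrable_iff_integrableOn_Ioc_of_le hab]
  exact (integrable_uncurry_tailKernel ν P k ha b).integral_prod_left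

theorem intervalIntegral_tailTransform_derivative (hP : P.eval 1 = 0) (k : ℕ) {a b : ℝ}
    (ha : 0 < a) (hab : a ≤ b) :
    ∫ y in a..b, tailTransform ν P.derivative (k + 1) y =
      tailTransform ν P k b - tailTransform ν P k a := by
  calc ∫ y in a..b, ∫ u, tailKernel P.derivative (k + 1) y u ∂ν
      = ∫ u, (∫ y in a..b, tailKernel P.derivative (k + 1) y u) ∂ν := by
        simp only [intervalIntegral.integral_of_le hab]
        exact integral_integral_swap (integrable_uncurry_tailKernel ν _ _ ha b)
    _ = ∫ u, (tailKernel P k b u - tailKernel P k a u) ∂ν := by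
        simp only [intervalIntegral_tailKernel_derivative hP k ha hab]
    _ = tailTransform ν P k b - tailTransform ν P k a :=
        integral_sub (integrable_tailKernel ν P k (ha.trans_le hab))
          (integrable_tailKernel ν P k ha)

theorem tailTransform_eq_add_intervalIntegral (hP : P.eval 1 = 0) (k : ℕ) {a b : ℝ}
    (ha : 0 < a) (hab : a ≤ b) :
    tailTransform ν P k b =
      tailTransform ν P k a + ∫ y in a..b, tailTransform ν P.derivative (k + 1) y := by
  rw [intervalIntegral_tailTransform_derivative ν hP k ha hab, add_sub_cancel]

theorem continuousAt_tailTransform (P : Polynomial ℝ) (k : ℕ) (hx : 0 < x)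
    (h : P.eval 1 = 0 ∨ ν {x} = 0) : ContinuousAt (tailTransform ν P k) x := by
  obtain ⟨C, hC, hPC⟩ := exists_abs_eval_le_on_unitInterval P
  refine continuousAt_of_dominated (bound := fun _ => C / (x / 2) ^ (k + 1))
    (.of_forall fun y => (measurable_tailKernel P k y).aestronglyMeasurable)
    ((lt_mem_nhds (half_lt_self hx)).mono fun y hy => ae_of_all _
      (abs_tailKernel_le_div_pow hC hPC k (half_pos hx) hy.le)) (integrable_const _) ?_
  rcases h with hP | hνx
  · exact ae_of_all _ (continuousAt_tailKernel hP k hx.ne')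
  · exact (measure_eq_zero_iff_ae_notMem.1 hνx).mono fun u hu =>
      (hasDerivAt_tailKernel P k (Ne.symm hu)).continuousAt

theorem hasDerivAt_tailTransform (hP : P.eval 1 = 0) (k : ℕ) (hx : 0 < x)
    (h : P.derivative.eval 1 = 0 ∨ ν {x} = 0) :
    HasDerivAt (tailTransform ν P k) (tailTransform ν P.derivative (k + 1) x) x := by
  have hderiv := (intervalIntegral.integral_hasDerivAt_right
    (intervalIntegrable_tailTransform ν P.derivative (k + 1) (half_pos hx) (half_le_self hx.le))
    (measurable_tailTransform ν _ _).stronglyMeasurable.stronglyMeasurableAtFilter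
    (continuousAt_tailTransform ν _ _ hx h)).const_add (tailTransform ν P k (x / 2))
  refine hderiv.congr_of_eventuallyEq ?_
  filter_upwards [lt_mem_nhds (half_lt_self hx)] with y hy
  exact tailTransform_eq_add_intervalIntegral ν hP k (half_pos hx) hy.le

end TailTransform

section AbsoluteContinuity

variable {f g : ℝ → ℝ} {a b : ℝ}

theorem absolutelyContinuousOnInterval_congr (h : EqOn f g (uIcc a b))
    (hf : AbsolutelyContinuousOnInterval f a b) : AbsolutelyContinuousOnInterval g a b := by
  rw [absolutelyContinuousOnInterval_iff] at hf ⊢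
  intro ε hε
  obtain ⟨δ, hδ, H⟩ := hf ε hε
  refine ⟨δ, hδ, fun E hE hlt => (Finset.sum_congr rfl fun i hi => ?_).trans_lt (H E hE hlt)⟩
  obtain ⟨hleft, hright⟩ := hE.1 i hi
  rw [h hleft, h hright]

theorem absolutelyContinuousOnInterval_of_eq_add_intervalIntegral (c : ℝ) (hab : a ≤ b)
    (hg : IntervalIntegrable g volume a b) (hf : ∀ x ∈ Icc a b, f x = c + ∫ y in a..x, g y) :
    AbsolutelyContinuousOnInterval f a b := by
  have hc : AbsolutelyContinuousOnInterval (fun _ : ℝ => c) a b :=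
    (LipschitzWith.const c).lipschitzOnWith.absolutelyContinuousOnInterval
  refine absolutelyContinuousOnInterval_congr (fun x hx => ?_)
    (hc.add (hg.absolutelyContinuousOnInterval_intervalIntegral left_mem_uIcc))
  exact (hf x (by rwa [uIcc_of_le hab] at hx)).symm

theorem IsACLoc.continuousOn (hf : IsACLoc f) : ContinuousOn f (Ioi 0) := by
  intro x (hx : 0 < x)
  have hcont := (hf (x / 2) (2 * x) (half_pos hx) (by linarith)).continuousOn
  rw [uIcc_of_le (by linarith)] at hcont
  exact (hcont.continuousAt (Icc_mem_nhds (by linarith) (by linarith))).continuousWithinAt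

theorem isACLocPow_one_iff : IsACLocPow 1 f ↔ IsACLoc f := by
  simp only [IsACLocPow, Nat.sub_self, iteratedDeriv_zero, Nat.cast_zero, WithTop.coe_zero,
    contDiffOn_zero, and_iff_right_iff_imp]
  exact IsACLoc.continuousOn

theorem contDiffOn_succ_of_hasDerivAt {s : Set ℝ} (hs : IsOpen s) {n : ℕ}
    (hf : ∀ x ∈ s, HasDerivAt f (g x) x) (hg : ContDiffOn ℝ n g s) :
    ContDiffOn ℝ (n + 1) f s :=
  (contDiffOn_succ_iff_deriv_of_isOpen hs).2
    ⟨fun x hx => (hf x hx).differentiableAt.differentiableWithinAt, by simp,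
      hg.congr fun x hx => (hf x hx).deriv⟩

theorem isACLocPow_succ_of_hasDerivAt {n : ℕ} (hf : ∀ x ∈ Ioi 0, HasDerivAt f (g x) x)
    (hg : IsACLocPow (n + 1) g) : IsACLocPow (n + 2) f := by
  obtain ⟨hdiff, hac⟩ := hg
  refine ⟨by exact_mod_cast contDiffOn_succ_of_hasDerivAt isOpen_Ioi hf hdiff,
    fun a b ha hab => absolutelyContinuousOnInterval_congr (fun x hx => ?_) (hac a b ha hab)⟩
  rw [uIcc_of_le hab] at hx
  have hderiv : EqOn g (deriv f) (Ioi 0) := fun y hy => (hf y hy).deriv.symm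
  simp only [Nat.add_sub_cancel, Nat.add_succ_sub_one, iteratedDeriv_succ']
  exact hderiv.iteratedDeriv_of_isOpen isOpen_Ioi n (ha.trans_le hx.1)

end AbsoluteContinuity

section Regularity

open Polynomial

variable (ν : Measure ℝ) [IsFiniteMeasure ν] {P : Polynomial ℝ} {n : ℕ}

theorem eval_eq_zero_of_pow_dvd {R : Type*} [CommRing R] {p : R[X]} {a : R} (hn : n ≠ 0)
    (hp : (X - C a) ^ n ∣ p) : p.eval a = 0 :=
  dvd_iff_isRoot.1 ((dvd_pow_self _ hn).trans hp)

theorem pow_dvd_derivative_of_pow_succ_dvd {R : Type*} [CommRing R] {p q : R[X]}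
    (h : q ^ (n + 1) ∣ p) : q ^ n ∣ derivative p := by
  simpa only [Nat.add_sub_cancel] using pow_sub_one_dvd_derivative_of_pow_dvd h

theorem isACLoc_tailTransform (hP : P.eval 1 = 0) (k : ℕ) : IsACLoc (tailTransform ν P k) :=
  fun _ _ ha hab => absolutelyContinuousOnInterval_of_eq_add_intervalIntegral _ hab
    (intervalIntegrable_tailTransform ν P.derivative (k + 1) ha hab)
    fun _ hx => tailTransform_eq_add_intervalIntegral ν hP k ha hx.1

theorem isACLocPow_tailTransform (hP : (X - C 1) ^ (n + 1) ∣ P) (k : ℕ) :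
    IsACLocPow (n + 1) (tailTransform ν P k) := by
  induction n generalizing P k with
  | zero =>
    exact isACLocPow_one_iff.2
      (isACLoc_tailTransform ν (eval_eq_zero_of_pow_dvd one_ne_zero hP) k)
  | succ n ih =>
    have hP' : (X - C 1) ^ (n + 1) ∣ P.derivative := pow_dvd_derivative_of_pow_succ_dvd hP
    exact isACLocPow_succ_of_hasDerivAt (fun x hx => hasDerivAt_tailTransform ν
      (eval_eq_zero_of_pow_dvd (Nat.succ_ne_zero _) hP) k hx
      (.inl (eval_eq_zero_of_pow_dvd (Nat.succ_ne_zero _) hP'))) (ih hP' (k + 1))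

theorem contDiffOn_tailTransform [NullSingletonClass ν] (hP : (X - C 1) ^ n ∣ P) (k : ℕ) :
    ContDiffOn ℝ n (tailTransform ν P k) (Ioi 0) := by
  induction n generalizing P k with
  | zero =>
    exact contDiffOn_zero.2 fun x hx =>
      (continuousAt_tailTransform ν P k hx (.inr (measure_singleton x))).continuousWithinAt
  | succ n ih =>
    have hP' : (X - C 1) ^ n ∣ P.derivative := pow_dvd_derivative_of_pow_succ_dvd hP
    exact_mod_cast contDiffOn_succ_of_hasDerivAt isOpen_Ioi (fun x hx =>
      hasDerivAt_tailTransform ν (eval_eq_zero_of_pow_dvd (Nat.succ_ne_zero _) hP) k hx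
        (.inr (measure_singleton x))) (ih hP' (k + 1))

theorem iteratedDeriv_tailTransform (hP : (X - C 1) ^ n ∣ P) (k : ℕ) {i : ℕ} (hi : i ≤ n)
    {x : ℝ} (hx : 0 < x) (h : i < n ∨ ν {x} = 0) :
    iteratedDeriv i (tailTransform ν P k) x = tailTransform ν (derivative^[i] P) (k + i) x := by
  induction i generalizing x with
  | zero => rfl
  | succ i ih =>
    have hroot {l : ℕ} (hl : l < n) : (derivative^[l] P).eval 1 = 0 :=
      eval_eq_zero_of_pow_dvd (Nat.sub_ne_zero_of_lt hl)
        (pow_sub_dvd_iterate_derivative_of_pow_dvd l hP)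
    have hloc : iteratedDeriv i (tailTransform ν P k) =ᶠ[𝓝 x]
        tailTransform ν (derivative^[i] P) (k + i) :=
      (eventually_gt_nhds hx).mono fun y hy => ih (Nat.le_of_succ_le hi) hy (.inl hi)
    rw [iteratedDeriv_succ, hloc.deriv_eq, Function.iterate_succ_apply']
    refine (hasDerivAt_tailTransform ν (hroot hi) (k + i) hx (h.imp_left fun hi => ?_)).deriv
    rw [← Function.iterate_succ_apply' derivative i P, hroot hi]

theorem ae_measure_singleton_eq_zero (μ : Measure ℝ) [NullSingletonClass μ] :
    ∀ᵐ x ∂μ, ν {x} = 0 := by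
  have hcount : {x | 0 < ν {x}}.Countable :=
    Measure.countable_meas_level_set_pos (g := id) measurable_id
  filter_upwards [hcount.ae_notMem μ] with x hx
  exact nonpos_iff_eq_zero.1 (not_lt.1 hx)

theorem ae_iteratedDeriv_tailTransform (hP : (X - C 1) ^ n ∣ P) (k : ℕ) {i : ℕ} (hi : i ≤ n) :
    iteratedDeriv i (tailTransform ν P k) =ᵐ[volume.restrict (Ioi 0)]
      tailTransform ν (derivative^[i] P) (k + i) := by
  filter_upwards [ae_restrict_mem measurableSet_Ioi, ae_measure_singleton_eq_zero ν _]
    with x hx hνx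
  exact iteratedDeriv_tailTransform ν hP k hi hx (.inr hνx)

end Regularity

/-! ### A Minkowski inequality for averages of dilations -/

section Dilations

variable {r : ℝ}

theorem rpow_lintegral_mul_le {α : Type*} [MeasurableSpace α] {μ : Measure α}
    {w h : α → ENNReal} (hw : Measurable w) (hh : Measurable h) (hr : 1 ≤ r) :
    (∫⁻ t, w t * h t ∂μ) ^ r ≤ (∫⁻ t, w t ∂μ) ^ (r - 1) * ∫⁻ t, w t * h t ^ r ∂μ := by
  have hr0 : 0 < r := one_pos.trans_le hr
  have hp : 0 ≤ 1 - r⁻¹ := sub_nonneg.2 (inv_le_one_of_one_le₀ hr)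
  have holder := ENNReal.lintegral_mul_norm_pow_le (μ := μ) hw.aemeasurable
    (hw.mul (hh.pow_const r)).aemeasurable hp (inv_nonneg.2 hr0.le) (sub_add_cancel _ _)
  have hsplit (t : α) : w t ^ (1 - r⁻¹) * (w t * h t ^ r) ^ r⁻¹ = w t * h t := by
    rw [ENNReal.mul_rpow_of_nonneg _ _ (inv_nonneg.2 hr0.le), ENNReal.rpow_rpow_inv hr0.ne',
      ← mul_assoc, ← ENNReal.rpow_add_of_nonneg _ _ hp (inv_nonneg.2 hr0.le), sub_add_cancel,
      ENNReal.rpow_one]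
  simp only [Pi.mul_apply, hsplit] at holder
  refine (ENNReal.rpow_le_rpow holder hr0.le).trans_eq ?_
  rw [ENNReal.mul_rpow_of_nonneg _ _ hr0.le, ENNReal.rpow_inv_rpow hr0.ne', ← ENNReal.rpow_mul,
    sub_mul, one_mul, inv_mul_cancel₀ hr0.ne']

theorem setLIntegral_Ioi_comp_mul_left {x : ℝ} (hx : 0 < x) (c : ℝ) (g : ℝ → ENNReal) :
    ∫⁻ u in Ioi (x * c), g u = ENNReal.ofReal x * ∫⁻ t in Ioi c, g (x * t) := by
  rw [← image_mul_left_Ioi hx, lintegral_image_eq_lintegral_abs_deriv_mul measurableSet_Ioi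
    (fun t _ => ((hasDerivAt_id' t).const_mul x).hasDerivWithinAt)
    (mul_right_injective₀ hx.ne').injOn, mul_one, abs_of_pos hx,
    lintegral_const_mul' _ _ ENNReal.ofReal_ne_top]

theorem setLIntegral_Ioi_rpow_inv_mul_comp_mul_rpow {t : ℝ} (ht : 0 < t) (hr : 0 < r)
    (g : ℝ → ENNReal) :
    ∫⁻ x in Ioi 0, (ENNReal.ofReal (t ^ r⁻¹) * g (x * t)) ^ r = ∫⁻ u in Ioi 0, g u ^ r := by
  have hpow (x : ℝ) : (ENNReal.ofReal (t ^ r⁻¹) * g (x * t)) ^ r =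
      ENNReal.ofReal t * g (t * x) ^ r := by
    rw [ENNReal.mul_rpow_of_nonneg _ _ hr.le, ENNReal.ofReal_rpow_of_pos (by positivity),
      Real.rpow_inv_rpow ht.le hr.ne', mul_comm x t]
  have hscale := setLIntegral_Ioi_comp_mul_left ht 0 fun u => g u ^ r
  rw [mul_zero] at hscale
  simp only [hpow, lintegral_const_mul' _ _ ENNReal.ofReal_ne_top, hscale]

theorem lintegral_rpow_lintegral_comp_mul_le {μ : Measure ℝ} [SFinite μ]
    (hμ : ∀ᵐ t ∂μ, 0 < t) {g : ℝ → ENNReal} (hg : Measurable g) (hr : 1 ≤ r) :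
    ∫⁻ x in Ioi 0, (∫⁻ t, g (x * t) ∂μ) ^ r ≤
      (∫⁻ t, ENNReal.ofReal (t ^ (-r⁻¹)) ∂μ) ^ r * ∫⁻ u in Ioi 0, g u ^ r := by
  have hr0 : 0 < r := one_pos.trans_le hr
  let w (t : ℝ) : ENNReal := ENNReal.ofReal (t ^ (-r⁻¹))
  let h (x t : ℝ) : ENNReal := ENNReal.ofReal (t ^ r⁻¹) * g (x * t)
  have hw : Measurable w := by fun_prop
  have hh : Measurable (Function.uncurry h) := by
    unfold h Function.uncurry
    fun_prop
  have hwh (x : ℝ) : ∫⁻ t, g (x * t) ∂μ = ∫⁻ t, w t * h x t ∂μ := by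
    refine lintegral_congr_ae (hμ.mono fun t ht => ?_)
    simp only [w, h]
    rw [← mul_assoc, ← ENNReal.ofReal_mul (by positivity), ← Real.rpow_add ht, neg_add_cancel,
      Real.rpow_zero, ENNReal.ofReal_one, one_mul]
  calc ∫⁻ x in Ioi 0, (∫⁻ t, g (x * t) ∂μ) ^ r
      ≤ ∫⁻ x in Ioi 0, (∫⁻ t, w t ∂μ) ^ (r - 1) * ∫⁻ t, w t * h x t ^ r ∂μ :=
        lintegral_mono fun x => (hwh x).symm ▸ rpow_lintegral_mul_le hw hh.of_uncurry_left hr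
    _ = (∫⁻ t, w t ∂μ) ^ (r - 1) * ∫⁻ t, w t * (∫⁻ x in Ioi 0, h x t ^ r) ∂μ := by
        have hwhr : Measurable (Function.uncurry fun x t => w t * h x t ^ r) :=
          (hw.comp measurable_snd).mul (hh.pow_const r)
        rw [lintegral_const_mul _ (by exact hwhr.lintegral_prod_right'),
          lintegral_lintegral_swap hwhr.aemeasurable]
        simp only [lintegral_const_mul _ (hh.of_uncurry_right.pow_const r)]
    _ = (∫⁻ t, w t ∂μ) ^ (r - 1) * ((∫⁻ t, w t ∂μ) * ∫⁻ u in Ioi 0, g u ^ r) := by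
        rw [← lintegral_mul_const _ hw]
        congr 1
        exact lintegral_congr_ae (hμ.mono fun t ht =>
          congrArg (w t * ·) (setLIntegral_Ioi_rpow_inv_mul_comp_mul_rpow ht hr0 g))
    _ = (∫⁻ t, w t ∂μ) ^ r * ∫⁻ u in Ioi 0, g u ^ r := by
        rw [← mul_assoc]
        nth_rw 2 [← ENNReal.rpow_one (∫⁻ t, w t ∂μ)]
        rw [← ENNReal.rpow_add_of_nonneg _ _ (sub_nonneg.2 hr) zero_le_one, sub_add_cancel]

theorem setLIntegral_Ioi_one_ofReal_rpow {b : ℝ} (hb : 0 < b) :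
    ∫⁻ t in Ioi (1 : ℝ), ENNReal.ofReal (t ^ (-1 - b)) = ENNReal.ofReal b⁻¹ := by
  rw [← ofReal_integral_eq_lintegral_ofReal
    (integrableOn_Ioi_rpow_of_lt (by linarith) one_pos), integral_Ioi_rpow_of_lt (by linarith)
    one_pos, Real.one_rpow, show -1 - b + 1 = -b by ring, neg_div_neg_eq, one_div]
  exact (ae_restrict_mem measurableSet_Ioi).mono fun t (ht : 1 < t) =>
    Real.rpow_nonneg (zero_le_one.trans ht.le) _

end Dilations

/-! ### Size of tail transforms -/

section Bounds

variable {ν : Measure ℝ}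

theorem pow_mul_tailTransform (ν : Measure ℝ) (P : Polynomial ℝ) (k : ℕ) {x : ℝ} (hx : 0 < x) :
    x ^ k * tailTransform ν P k x = tailTransform ν (Polynomial.X ^ k * P) 0 x := by
  simp only [tailTransform_eq_setIntegral, ← integral_const_mul]
  refine setIntegral_congr_fun measurableSet_Ioi fun u (hu : x < u) => ?_
  have hu0 : 0 < u := hx.trans hu
  simp only [Polynomial.eval_mul, Polynomial.eval_pow, Polynomial.eval_X, div_pow]
  field_simp
  ring

theorem exists_enorm_tailTransform_le (ν : Measure ℝ) (P : Polynomial ℝ) :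
    ∃ C, ∀ x, 0 < x →
      ‖tailTransform ν P 0 x‖ₑ ≤ ENNReal.ofReal C * ∫⁻ u in Ioi x, ENNReal.ofReal u⁻¹ ∂ν := by
  obtain ⟨C, hC, hPC⟩ := exists_abs_eval_le_on_unitInterval P
  refine ⟨C, fun x hx => ?_⟩
  rw [tailTransform_eq_setIntegral, ← lintegral_const_mul' _ _ ENNReal.ofReal_ne_top]
  refine (enorm_integral_le_lintegral_enorm _).trans
    (setLIntegral_mono' measurableSet_Ioi fun u hu => ?_)
  rw [← tailKernel_of_lt P 0 hu, Real.enorm_eq_ofReal_abs, ← ENNReal.ofReal_mul hC]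
  exact ENNReal.ofReal_le_ofReal (by simpa [div_eq_mul_inv] using abs_tailKernel_le hPC 0 hx.le hu)

theorem tendsto_mul_tailTransform_atTop (ν : Measure ℝ) [IsFiniteMeasure ν] (P : Polynomial ℝ) :
    Tendsto (fun x => x * tailTransform ν P 0 x) atTop (𝓝 0) := by
  obtain ⟨C, hC, hPC⟩ := exists_abs_eval_le_on_unitInterval P
  simp only [tailTransform, ← integral_const_mul]
  rw [← integral_zero ℝ ℝ (μ := ν)]
  refine tendsto_integral_filter_of_dominated_convergence (fun _ => C)
    (.of_forall fun x => ((measurable_tailKernel P 0 x).const_mul x).aestronglyMeasurable) ?_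
    (integrable_const C) (ae_of_all _ fun u => ?_)
  · filter_upwards [eventually_gt_atTop 0] with x hx
    refine ae_of_all _ fun u => ?_
    have hbound := abs_tailKernel_le_div_pow hC hPC 0 hx le_rfl u
    rwa [zero_add, pow_one, le_div_iff₀' hx, ← abs_of_pos hx, ← abs_mul, abs_of_pos hx] at hbound
  · refine tendsto_const_nhds.congr' ?_
    filter_upwards [eventually_ge_atTop u] with x hx
    rw [tailKernel_of_le P 0 hx, mul_zero]

theorem isLittleO_tailTransform (ν : Measure ℝ) [IsFiniteMeasure ν] (P : Polynomial ℝ) (k : ℕ) :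
    tailTransform ν P k =o[atTop] fun x => 1 / x ^ (k + 1) := by
  rw [Asymptotics.isLittleO_iff_tendsto']
  · refine (tendsto_mul_tailTransform_atTop ν (Polynomial.X ^ k * P)).congr' ?_
    filter_upwards [eventually_gt_atTop 0] with x hx
    rw [← pow_mul_tailTransform ν P k hx, ← mul_assoc, ← pow_succ', div_div_eq_mul_div, div_one,
      mul_comm]
  · filter_upwards [eventually_gt_atTop 0] with x hx hzero
    exact absurd hzero (by positivity)

theorem memLp_top_tailTransform [SFinite ν] (hν : IntegrableOn (fun u : ℝ => 1 / u) (Ioi 0) ν)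
    (P : Polynomial ℝ) : MemLp (tailTransform ν P 0) ⊤ (volume.restrict (Ioi 0)) := by
  obtain ⟨C, hbound⟩ := exists_enorm_tailTransform_le ν P
  have hfin : ENNReal.ofReal C * ∫⁻ u in Ioi 0, ENNReal.ofReal u⁻¹ ∂ν < ⊤ :=
    ENNReal.mul_lt_top ENNReal.ofReal_lt_top
      ((lintegral_mono fun u => (one_div u) ▸ Real.ofReal_le_enorm _).trans_lt hν.2)
  refine ⟨(measurable_tailTransform ν P 0).aestronglyMeasurable, ?_⟩
  rw [eLpNorm_exponent_top]
  refine (eLpNormEssSup_le_of_ae_enorm_bound ?_).trans_lt hfin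
  refine (ae_restrict_mem measurableSet_Ioi).mono fun x hx => (hbound x hx).trans ?_
  gcongr
  exact le_of_lt hx

theorem setLIntegral_Ioi_inv_withDensity {g : ℝ → ENNReal} (hg : Measurable g) {x : ℝ}
    (hx : 0 < x) :
    ∫⁻ u in Ioi x, ENNReal.ofReal u⁻¹ ∂(volume.restrict (Ioi 0)).withDensity g =
      ∫⁻ t in Ioi 1, g (x * t) * ENNReal.ofReal t⁻¹ := by
  have hscale := setLIntegral_Ioi_comp_mul_left hx 1 fun u => g u * ENNReal.ofReal u⁻¹
  rw [mul_one, ← lintegral_const_mul' _ _ ENNReal.ofReal_ne_top] at hscale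
  rw [restrict_withDensity measurableSet_Ioi, Measure.restrict_restrict measurableSet_Ioi,
    inter_eq_left.2 (Ioi_subset_Ioi hx.le), lintegral_withDensity_eq_lintegral_mul _ hg
    (by fun_prop)]
  refine hscale.trans (lintegral_congr fun t => ?_)
  rw [mul_left_comm, ← ENNReal.ofReal_mul hx.le, mul_inv, mul_inv_cancel_left₀ hx.ne']

theorem lintegral_rpow_setLIntegral_Ioi_inv_withDensity_le {g : ℝ → ENNReal} (hg : Measurable g)
    {r : ℝ} (hr : 1 ≤ r) :
    ∫⁻ x in Ioi 0,
        (∫⁻ u in Ioi x, ENNReal.ofReal u⁻¹ ∂(volume.restrict (Ioi 0)).withDensity g) ^ r ≤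
      ENNReal.ofReal r ^ r * ∫⁻ u in Ioi 0, g u ^ r := by
  have hr0 : 0 < r := one_pos.trans_le hr
  let μ := (volume.restrict (Ioi (1 : ℝ))).withDensity fun t => ENNReal.ofReal t⁻¹
  have hμ (f : ℝ → ENNReal) (hf : Measurable f) :
      ∫⁻ t, f t ∂μ = ∫⁻ t in Ioi 1, f t * ENNReal.ofReal t⁻¹ := by
    rw [lintegral_withDensity_eq_lintegral_mul _ (by fun_prop) hf]
    simp only [Pi.mul_apply, mul_comm]
  have hpos : ∀ᵐ t ∂μ, 0 < t := (withDensity_absolutelyContinuous _ _).ae_le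
    ((ae_restrict_mem measurableSet_Ioi).mono fun t ht => one_pos.trans ht)
  have hmass : ∫⁻ t, ENNReal.ofReal (t ^ (-r⁻¹)) ∂μ = ENNReal.ofReal r := by
    rw [hμ _ (by fun_prop)]
    refine (setLIntegral_congr_fun measurableSet_Ioi fun t (ht : 1 < t) => ?_).trans
      ((setLIntegral_Ioi_one_ofReal_rpow (inv_pos.2 hr0)).trans (by rw [inv_inv]))
    have ht0 : 0 < t := one_pos.trans ht
    rw [← ENNReal.ofReal_mul (by positivity), ← Real.rpow_neg_one t, ← Real.rpow_add ht0]
    ring_nf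
  rw [← hmass]
  refine le_trans (setLIntegral_mono' measurableSet_Ioi fun x hx => le_of_eq ?_)
    (lintegral_rpow_lintegral_comp_mul_le hpos hg hr)
  rw [setLIntegral_Ioi_inv_withDensity hg hx, hμ _ (by fun_prop)]

theorem memLp_tailTransform {p : ENNReal} (hp : 1 ≤ p) (hp' : p ≠ ⊤) {g : ℝ → ENNReal}
    (hg : Measurable g) (hgp : ∫⁻ u in Ioi 0, g u ^ p.toReal < ⊤) (P : Polynomial ℝ) :
    MemLp (tailTransform ((volume.restrict (Ioi 0)).withDensity g) P 0) p
      (volume.restrict (Ioi 0)) := by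
  have hr : 1 ≤ p.toReal := by simpa using ENNReal.toReal_mono hp' hp
  have hr0 : 0 ≤ p.toReal := zero_le_one.trans hr
  obtain ⟨C, hbound⟩ :=
    exists_enorm_tailTransform_le ((volume.restrict (Ioi 0)).withDensity g) P
  refine ⟨(measurable_tailTransform _ P 0).aestronglyMeasurable, ?_⟩
  rw [eLpNorm_lt_top_iff_lintegral_rpow_enorm_lt_top (one_pos.trans_le hp).ne' hp']
  refine (setLIntegral_mono' measurableSet_Ioi fun x hx =>
    (ENNReal.rpow_le_rpow (hbound x hx) hr0).trans_eq
      (ENNReal.mul_rpow_of_nonneg _ _ hr0)).trans_lt ?_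
  have hCr : ENNReal.ofReal C ^ p.toReal ≠ ⊤ :=
    ENNReal.rpow_ne_top_of_nonneg hr0 ENNReal.ofReal_ne_top
  rw [lintegral_const_mul' _ _ hCr]
  refine ENNReal.mul_lt_top hCr.lt_top
    ((lintegral_rpow_setLIntegral_Ioi_inv_withDensity_le hg hr).trans_lt
      (ENNReal.mul_lt_top ?_ hgp))
  exact ENNReal.rpow_lt_top_of_nonneg hr0 ENNReal.ofReal_ne_top

theorem memLp_tailTransform_withDensity_ofReal {p : ENNReal} (hp : 1 ≤ p) (hp' : p ≠ ⊤)
    {q : ℝ → ℝ} (hq : MemLp q p (volume.restrict (Ioi 0))) (P : Polynomial ℝ) :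
    MemLp (tailTransform ((volume.restrict (Ioi 0)).withDensity fun u => ENNReal.ofReal (q u)) P 0)
      p (volume.restrict (Ioi 0)) := by
  have hae : q =ᵐ[volume.restrict (Ioi 0)] hq.1.mk q := hq.1.ae_eq_mk
  rw [withDensity_congr_ae (hae.mono fun u hu => congrArg ENNReal.ofReal hu)]
  refine memLp_tailTransform hp hp' hq.1.stronglyMeasurable_mk.measurable.ennreal_ofReal
    (lt_of_le_of_lt (lintegral_mono fun u => ?_)
      ((eLpNorm_lt_top_iff_lintegral_rpow_enorm_lt_top (one_pos.trans_le hp).ne' hp').1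
        ((memLp_congr_ae hae).1 hq).2)) P
  gcongr
  exact Real.ofReal_le_enorm _

end Bounds

section Origin

variable {ν : Measure ℝ}

theorem tailTransform_zero_zero (ν : Measure ℝ) (P : Polynomial ℝ) :
    tailTransform ν P 0 0 = P.eval 0 * ∫ u in Ioi 0, 1 / u ∂ν := by
  simp only [tailTransform_eq_setIntegral, ← integral_const_mul, zero_div, zero_add, pow_one,
    mul_one_div]

theorem tendsto_tailTransform_nhdsGT_zero (hν : IntegrableOn (fun u : ℝ => 1 / u) (Ioi 0) ν)
    (P : Polynomial ℝ) :
    Tendsto (tailTransform ν P 0) (𝓝[>] 0) (𝓝 (tailTransform ν P 0 0)) := by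
  obtain ⟨C, hC, hPC⟩ := exists_abs_eval_le_on_unitInterval P
  refine tendsto_integral_filter_of_dominated_convergence
    (bound := (Ioi 0).indicator fun u => C * (1 / u))
    (.of_forall fun x => (measurable_tailKernel P 0 x).aestronglyMeasurable) ?_
    ((integrable_indicator_iff measurableSet_Ioi).2 (hν.const_mul C)) (ae_of_all _ fun u => ?_)
  · filter_upwards [self_mem_nhdsWithin] with x (hx : 0 < x)
    refine ae_of_all _ fun u => ?_
    rcases lt_or_ge x u with hu | hu
    · rw [indicator_of_mem (show u ∈ Ioi 0 from hx.trans hu), mul_one_div]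
      simpa using abs_tailKernel_le hPC 0 hx.le hu
    · rw [tailKernel_of_le P 0 hu, norm_zero]
      exact indicator_nonneg (fun u (hu : 0 < u) => by positivity) u
  · rcases eq_or_ne 0 u with rfl | hu
    · refine tendsto_const_nhds.congr' ?_
      filter_upwards [self_mem_nhdsWithin] with x (hx : 0 < x)
      rw [tailKernel_of_le P 0 hx.le, tailKernel_of_le P 0 le_rfl]
    · exact (hasDerivAt_tailKernel P 0 hu).continuousAt.mono_left nhdsWithin_le_nhds

end Origin

/-! ### The distribution function -/

section Distribution

variable {μ : Measure ℝ} [IsFiniteMeasure μ] {g : ℝ → ℝ}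

theorem integrableOn_of_restrict_eq_withDensity (hg : Measurable g)
    (hg0 : ∀ x, 0 < x → 0 ≤ g x) (hμ : μ.restrict (Ioi 0) =
      (volume.restrict (Ioi 0)).withDensity fun x => ENNReal.ofReal (g x)) :
    IntegrableOn g (Ioi 0) := by
  refine ⟨hg.aestronglyMeasurable, ?_⟩
  rw [hasFiniteIntegral_iff_ofReal ((ae_restrict_mem measurableSet_Ioi).mono hg0),
    ← setLIntegral_univ, ← withDensity_apply _ .univ, ← hμ]
  exact measure_lt_top _ _

theorem measureReal_Iic_eq_add_intervalIntegral (hg : IntegrableOn g (Ioi 0))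
    (hg0 : ∀ x, 0 < x → 0 ≤ g x) (hμ : μ.restrict (Ioi 0) =
      (volume.restrict (Ioi 0)).withDensity fun x => ENNReal.ofReal (g x)) {x : ℝ} (hx : 0 ≤ x) :
    μ.real (Iic x) = μ.real (Iic 0) + ∫ y in 0..x, g y := by
  have hsub : Ioc 0 x ⊆ Ioi 0 := fun y hy => hy.1
  have hIoc : μ (Ioc 0 x) = ∫⁻ y in Ioc 0 x, ENNReal.ofReal (g y) := by
    rw [← Measure.restrict_eq_self μ hsub, hμ, withDensity_apply _ measurableSet_Ioc,
      Measure.restrict_restrict measurableSet_Ioc, inter_eq_left.2 hsub]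
  rw [← Iic_union_Ioc_eq_Iic hx, measureReal_union (Iic_disjoint_Ioc le_rfl) measurableSet_Ioc,
    intervalIntegral.integral_of_le hx, measureReal_def (s := Ioc 0 x), hIoc,
    integral_eq_lintegral_of_nonneg_ae _ (hg.mono_set hsub).1]
  exact (ae_restrict_mem measurableSet_Ioc).mono fun y hy => hg0 y hy.1

theorem absolutelyContinuousOnInterval_measureReal_Iic (hg : IntegrableOn g (Ioi 0))
    (hg0 : ∀ x, 0 < x → 0 ≤ g x) (hμ : μ.restrict (Ioi 0) =
      (volume.restrict (Ioi 0)).withDensity fun x => ENNReal.ofReal (g x)) {a : ℝ} (ha : 0 ≤ a) :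
    AbsolutelyContinuousOnInterval (fun x => μ.real (Iic x)) 0 a :=
  absolutelyContinuousOnInterval_of_eq_add_intervalIntegral (μ.real (Iic 0)) ha
    ((intervalIntegrable_iff_integrableOn_Ioc_of_le ha).2 (hg.mono_set fun _ hy => hy.1))
    fun _ hx => measureReal_Iic_eq_add_intervalIntegral hg hg0 hμ hx.1

theorem isACLoc_measureReal_Iic (hg : IntegrableOn g (Ioi 0))
    (hg0 : ∀ x, 0 < x → 0 ≤ g x) (hμ : μ.restrict (Ioi 0) =
      (volume.restrict (Ioi 0)).withDensity fun x => ENNReal.ofReal (g x)) :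
    IsACLoc fun x => μ.real (Iic x) := fun a b ha hab =>
  (absolutelyContinuousOnInterval_measureReal_Iic hg hg0 hμ (ha.le.trans hab)).mono <| by
    rw [uIcc_of_le hab, uIcc_of_le (ha.le.trans hab)]
    exact Icc_subset_Icc_left ha.le

theorem hasDerivAt_measureReal_Iic (hg : IntegrableOn g (Ioi 0))
    (hg0 : ∀ x, 0 < x → 0 ≤ g x) (hμ : μ.restrict (Ioi 0) =
      (volume.restrict (Ioi 0)).withDensity fun x => ENNReal.ofReal (g x)) {x : ℝ} (hx : 0 < x)
    (hc : ContinuousAt g x) : HasDerivAt (fun x => μ.real (Iic x)) (g x) x := by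
  have hint : IntervalIntegrable g volume 0 x :=
    (intervalIntegrable_iff_integrableOn_Ioc_of_le hx.le).2 (hg.mono_set fun _ hy => hy.1)
  have hderiv := (intervalIntegral.integral_hasDerivAt_right hint
    ⟨Ioi 0, Ioi_mem_nhds hx, hg.1⟩ hc).const_add (μ.real (Iic 0))
  refine hderiv.congr_of_eventuallyEq ?_
  filter_upwards [Ioi_mem_nhds hx] with y hy
  exact measureReal_Iic_eq_add_intervalIntegral hg hg0 hμ (le_of_lt hy)

theorem isACLocPow_measureReal_Iic {j : ℕ} (hj : 1 ≤ j) (hg : IntegrableOn g (Ioi 0))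
    (hg0 : ∀ x, 0 < x → 0 ≤ g x) (hμ : μ.restrict (Ioi 0) =
      (volume.restrict (Ioi 0)).withDensity fun x => ENNReal.ofReal (g x))
    (hgj : 2 ≤ j → IsACLocPow (j - 1) g) : IsACLocPow j fun x => μ.real (Iic x) := by
  rcases hj.eq_or_lt with rfl | hj2
  · exact isACLocPow_one_iff.2 (isACLoc_measureReal_Iic hg hg0 hμ)
  · obtain ⟨i, rfl⟩ := Nat.exists_eq_add_of_le' hj2
    exact isACLocPow_succ_of_hasDerivAt (fun x hx => hasDerivAt_measureReal_Iic hg hg0 hμ hx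
      ((hgj hj2).1.continuousOn.continuousAt (Ioi_mem_nhds hx))) (hgj hj2)

end Distribution

/-! ### Regularity and size of the transition density -/

section TransitionDensity

open Polynomial

/-- The polynomial `(2 / B(m/2,j)) X^{m-1} (1 - X²)^{j-1}`, whose tail transform with `k = 0` is
the transition density. -/
def transitionPoly (m j : ℕ) : ℝ[X] :=
  C (2 / beta (m / 2) j) * X ^ (m - 1) * (1 - X ^ 2) ^ (j - 1)

theorem X_sub_one_pow_dvd_transitionPoly (m j : ℕ) : (X - C 1) ^ (j - 1) ∣ transitionPoly m j :=
  .mul_left (pow_dvd_pow_of_dvd ⟨-(X + 1), by rw [C_1]; ring⟩ _) _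

theorem eval_zero_transitionPoly (m j : ℕ) :
    (transitionPoly m j).eval 0 = 2 / beta (m / 2) j * 0 ^ (m - 1) := by
  simp [transitionPoly]

variable {m j : ℕ}

theorem transitionDensity_eq_tailTransform (hm : 1 ≤ m) (j : ℕ) (ν : Measure ℝ) :
    transitionDensity m j ν = tailTransform ν (transitionPoly m j) 0 := by
  obtain ⟨l, rfl⟩ := Nat.exists_eq_add_of_le' hm
  funext x
  rw [transitionDensity, tailTransform_eq_setIntegral, ← integral_const_mul]
  congr 1 with u
  simp only [transitionPoly, eval_mul, eval_C, eval_pow, eval_X, eval_sub, eval_one, div_pow,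
    Nat.add_sub_cancel]
  ring

theorem measurable_transitionDensity (hm : 1 ≤ m) (j : ℕ) (ν : Measure ℝ) [SFinite ν] :
    Measurable (transitionDensity m j ν) := by
  rw [transitionDensity_eq_tailTransform hm]
  exact measurable_tailTransform ν _ 0

theorem transitionDensity_nonneg (hm : 1 ≤ m) (hj : 1 ≤ j) (ν : Measure ℝ) {x : ℝ} (hx : 0 < x) :
    0 ≤ transitionDensity m j ν x := by
  have hB := beta_pos (half_pos (Nat.cast_pos.2 hm)) (Nat.cast_pos.2 hj : (0 : ℝ) < j)
  refine mul_nonneg (by positivity) (setIntegral_nonneg measurableSet_Ioi fun u (hu : x < u) => ?_)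
  have hu0 : 0 < u := hx.trans hu
  have hxu : 0 ≤ 1 - x ^ 2 / u ^ 2 := by
    rw [sub_nonneg, div_le_one (pow_pos hu0 2)]
    gcongr
  positivity

theorem transitionDensity_zero (hm : 1 ≤ m) (j : ℕ) (ν : Measure ℝ) :
    transitionDensity m j ν 0 = 2 / beta (m / 2) j * 0 ^ (m - 1) * ∫ u in Ioi 0, 1 / u ∂ν := by
  rw [transitionDensity_eq_tailTransform hm, tailTransform_zero_zero, eval_zero_transitionPoly]

theorem tendsto_transitionDensity_nhdsGT_zero (hm : 1 ≤ m) (j : ℕ)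
    {ν : Measure ℝ} (hν : IntegrableOn (fun u : ℝ => 1 / u) (Ioi 0) ν) :
    Tendsto (transitionDensity m j ν) (𝓝[>] 0) (𝓝 (transitionDensity m j ν 0)) := by
  rw [transitionDensity_eq_tailTransform hm]
  exact tendsto_tailTransform_nhdsGT_zero hν _

variable (ν : Measure ℝ) [IsFiniteMeasure ν]

theorem isACLocPow_transitionDensity (hm : 1 ≤ m) (hj : 2 ≤ j) :
    IsACLocPow (j - 1) (transitionDensity m j ν) := by
  have hdvd := X_sub_one_pow_dvd_transitionPoly m j
  rw [transitionDensity_eq_tailTransform hm]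
  obtain ⟨i, rfl⟩ := Nat.exists_eq_add_of_le' hj
  exact isACLocPow_tailTransform ν hdvd 0

theorem contDiffOn_transitionDensity [NullSingletonClass ν] (hm : 1 ≤ m) (j : ℕ) :
    ContDiffOn ℝ ((j - 1 : ℕ) : ℕ∞) (transitionDensity m j ν) (Ioi 0) := by
  rw [transitionDensity_eq_tailTransform hm]
  exact contDiffOn_tailTransform ν (X_sub_one_pow_dvd_transitionPoly m j) 0

theorem ae_pow_mul_iteratedDeriv_transitionDensity (hm : 1 ≤ m) {k : ℕ} (hk : k < j) :
    (fun x => x ^ k * iteratedDeriv k (transitionDensity m j ν) x) =ᵐ[volume.restrict (Ioi 0)]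
      tailTransform ν (X ^ k * derivative^[k] (transitionPoly m j)) 0 := by
  rw [transitionDensity_eq_tailTransform hm]
  filter_upwards [ae_restrict_mem measurableSet_Ioi, ae_iteratedDeriv_tailTransform ν
    (X_sub_one_pow_dvd_transitionPoly m j) 0 (Nat.le_sub_one_of_lt hk)] with x hx hderiv
  rw [hderiv, zero_add, pow_mul_tailTransform ν _ k hx]

theorem isLittleO_iteratedDeriv_transitionDensity [NullSingletonClass ν] (hm : 1 ≤ m) {k : ℕ}
    (hk : k < j) :
    iteratedDeriv k (transitionDensity m j ν) =o[atTop] fun x => 1 / x ^ (k + 1) := by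
  rw [transitionDensity_eq_tailTransform hm]
  refine (isLittleO_tailTransform ν (derivative^[k] (transitionPoly m j)) k).congr' ?_ .rfl
  filter_upwards [eventually_gt_atTop 0] with x hx
  rw [iteratedDeriv_tailTransform ν (X_sub_one_pow_dvd_transitionPoly m j) 0
    (Nat.le_sub_one_of_lt hk) hx (.inr (measure_singleton x)), zero_add]

variable {ν}

theorem memLp_top_pow_mul_iteratedDeriv_transitionDensity (hm : 1 ≤ m) {k : ℕ} (hk : k < j)
    (hν : IntegrableOn (fun u : ℝ => 1 / u) (Ioi 0) ν) :
    MemLp (fun x => x ^ k * iteratedDeriv k (transitionDensity m j ν) x) ⊤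
      (volume.restrict (Ioi 0)) :=
  (memLp_congr_ae (ae_pow_mul_iteratedDeriv_transitionDensity ν hm hk)).2
    (memLp_top_tailTransform hν _)

theorem memLp_pow_mul_iteratedDeriv_transitionDensity (hm : 1 ≤ m) {k : ℕ} (hk : k < j)
    {p : ENNReal} (hp : 1 ≤ p) (hp' : p ≠ ⊤) {q : ℝ → ℝ}
    (hν : ν = (volume.restrict (Ioi 0)).withDensity fun x => ENNReal.ofReal (q x))
    (hq : MemLp q p (volume.restrict (Ioi 0))) :
    MemLp (fun x => x ^ k * iteratedDeriv k (transitionDensity m j ν) x) p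
      (volume.restrict (Ioi 0)) := by
  refine (memLp_congr_ae (ae_pow_mul_iteratedDeriv_transitionDensity ν hm hk)).2 ?_
  rw [hν]
  exact memLp_tailTransform_withDensity_ofReal hp hp' hq _

end TransitionDensity

end

theorem mainTheorem5 (m j : ℕ) (hm : 1 ≤ m) (hj : 1 ≤ j) (f : ℝ → ℝ)
    (hnonconst : ¬ ∃ c : ℝ, ∀ r : ℝ, 0 ≤ r → f r = c)
    (hfm : IsRPD m f) (νm : Measure ℝ) (hνm : IsSchoenbergMeasure m f νm)
    (hf : IsRPD (m + 2 * j) f) (ν : Measure ℝ) (hν : IsSchoenbergMeasure (m + 2 * j) f ν) :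
    -- `p_m` is the density of `ν_m` on `(0,∞)`
    νm.restrict (Ioi 0) = (volume.restrict (Ioi 0)).withDensity
        (fun x => ENNReal.ofReal (transitionDensity m j ν x)) ∧
    -- (i)
    ((∀ a : ℝ, 0 < a → AbsolutelyContinuousOnInterval (fun x => νm.real (Iic x)) 0 a) ∧
      IsACLocPow j (fun x => νm.real (Iic x)) ∧
      (2 ≤ j → IsACLocPow (j - 1) (transitionDensity m j ν))) ∧
    -- (ii)
    (∀ (p : ENNReal) (q : ℝ → ℝ), 1 ≤ p → p ≠ ⊤ → (∀ x, 0 ≤ q x) →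
      ν = (volume.restrict (Ioi 0)).withDensity (fun x => ENNReal.ofReal (q x)) →
      MemLp q p (volume.restrict (Ioi 0)) →
        ContDiffOn ℝ ((j - 1 : ℕ) : ℕ∞) (transitionDensity m j ν) (Ioi 0) ∧
        ∀ k < j,
          MemLp (fun x => x ^ k * iteratedDeriv k (transitionDensity m j ν) x) p
            (volume.restrict (Ioi 0)) ∧
          (fun x => iteratedDeriv k (transitionDensity m j ν) x)
            =o[atTop] (fun x : ℝ => 1 / x ^ (k + 1))) ∧
    -- (iii)
    (IntegrableOn (fun u : ℝ => 1 / u) (Ioi 0) ν →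
      (2 ≤ m → transitionDensity m j ν 0 = 0 ∧
        Tendsto (transitionDensity m j ν) (𝓝[>] 0) (𝓝 0)) ∧
      (m = 1 →
        transitionDensity m j ν 0
          = 2 / ProbabilityTheory.beta (1 / 2) j * ∫ u in Ioi (0 : ℝ), 1 / u ∂ν ∧
        Tendsto (transitionDensity m j ν) (𝓝[>] 0)
          (𝓝 (2 / ProbabilityTheory.beta (1 / 2) j * ∫ u in Ioi (0 : ℝ), 1 / u ∂ν))) ∧
      ∀ k < j,
        MemLp (fun x => x ^ k * iteratedDeriv k (transitionDensity m j ν) x) ⊤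
          (volume.restrict (Ioi 0))) := by
  have := hνm.finite
  have := hν.finite
  have hdens := hνm.restrict_Ioi_eq_withDensity hm hj hν
  have hnonneg (x : ℝ) (hx : 0 < x) := transitionDensity_nonneg hm hj ν hx
  have hint := integrableOn_of_restrict_eq_withDensity
    (measurable_transitionDensity hm j ν) hnonneg hdens
  have hAC := isACLocPow_transitionDensity (j := j) ν hm
  refine ⟨hdens, ⟨fun a ha => absolutelyContinuousOnInterval_measureReal_Iic hint hnonneg hdens
    ha.le, isACLocPow_measureReal_Iic hj hint hnonneg hdens hAC, hAC⟩, ?_, fun hI => ?_⟩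
  · intro p q hp hp' _ hνq hq
    have : NullSingletonClass ν := by rw [hνq]; infer_instance
    exact ⟨contDiffOn_transitionDensity ν hm j, fun k hk =>
      ⟨memLp_pow_mul_iteratedDeriv_transitionDensity hm hk hp hp' hνq hq,
        isLittleO_iteratedDeriv_transitionDensity ν hm hk⟩⟩
  · have hlim := tendsto_transitionDensity_nhdsGT_zero hm j hI
    have hzero := transitionDensity_zero hm j ν
    refine ⟨fun hm2 => ?_, ?_, fun k hk =>
      memLp_top_pow_mul_iteratedDeriv_transitionDensity hm hk hI⟩
    · rw [zero_pow (Nat.sub_ne_zero_of_lt hm2), mul_zero, zero_mul] at hzero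
      exact ⟨hzero, by rwa [hzero] at hlim⟩
    · rintro rfl
      rw [Nat.cast_one, Nat.sub_self, pow_zero, mul_one] at hzero
      exact ⟨hzero, by rwa [hzero] at hlim⟩
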